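/- Let $E=\mathbb R^3$. For $g:E\times E\to[0,\infty)$ put $\rho_g(x)=\int_E g(x,v)\,dv$ and $U_g(x)=-\int_E\frac{\rho_g(y)}{|y-x|}\,dy$. For $x,v\in E$ write $r=|x|$, $p_r=\frac{x\cdot v}{|x|}$ (if $x\ne0$) and $\beta=|x\wedge v|^2=|x|^2|v|^2-(x\cdot v)^2$. A function $f=f(t,x,v)\ge0$ on $\mathbb R\times E\times E$ is called a solution of the gravitational Vlasov–Poisson system if the integrals defining $\rho_{f(t)}$ (for almost every $x$) and $U_{f(t)}$ (for every $x$) converge for all $t$, and if at every point with $f\neq0$ the functions $f$ and $U_{f(t)}$ are differentiable and $$\partial_t f+v\cdot\nabla_x f-\nabla_xU_{f(t)}\cdot\nabla_v f=0 .$$ Let $Q=Q(x,v)$ be a time-independent solution that is invariant under $(x,v)\mapsto(Ax,Av)$, $A\in SO(3)$, and of the form $Q(x,v)=\tilde Q(e_Q(x,v),\beta)$ with $e_Q(x,v)=\frac12|v|^2+U_Q(x)$. Write $U_Q(r)$ for the radial function $U_Q$ (extended evenly to $r<0$) and $e_Q(r,p_r,\beta)=\frac12p_r^2+U_Q(r)+\frac{\beta}{2r^2}$.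 Suppose that $Q(0,v)\neq0$ for some $v$, and that the set of all $(r,p_r)$ belonging to points with $x\neq 0$ and $Q(x,v)\neq0$ is connected. Let $R=R(t,r,p_r)$ and $P=P(t,r,p_r)$ be $C^2$ functions on $\mathbb R\times(0,\infty)\times\mathbb R$, and let $f$ be a solution of the Vlasov–Poisson system such that for $x\neq0$ $$f(t,x,v)=\tilde Q\big(e_Q(R(t,r,p_r),P(t,r,p_r),\beta),\beta\big).$$ Suppose that $f$, restricted to $x\neq0$, is not independent of $t$, and that there is a function $H=H(t,r,p_r)$, of class $C^2$ in $(r,p_r)\in(0,\infty)\times\mathbb R$ for every $t$, such that $\partial_tR=(\partial_{p_r}H)(t,R,P)$ and $\partial_tP=-(\partial_rH)(t,R,P)$. Assume moreover: (a) at all points $(e_Q(x,v),\beta)$ with $Q(x,v)\neq0$ the function $\tilde Q$ is differentiable (as a function on $\mathbb R\times[0,\infty)$) and $\partial_e\tilde Q\neq0$; and $U_Q'(0)=0$; (b) $\partial_rR>0$, and there is a function $\sigma(t)$ such that $\lim_{\delta\to0^+}R(t,\delta,p_r)/\delta=\sigma(t)$ for all $t$ and $p_r$; (c) $\det\dfrac{\partial(R(0,r,p_r),P(0,r,p_r))}{\partial(r,p_r)}=1$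 for all $r>0$ and $p_r\in\mathbb R$. Then $\alpha=U_Q''(0)$ exists, and $U_Q'(r)=\alpha r$ for all $r=|x|$ such that $Q(x,v)\neq0$ for some $v$. Furthermore there is a twice differentiable function $\phi:\mathbb R\to(0,\infty)$ with $$\ddot\phi(t)=\alpha\Big(-\frac1{\phi(t)^2}+\frac1{\phi(t)^3}\Big)\qquad(t\in\mathbb R)$$ such that, for all $(t,x,v)$ with $x\ne0$ and $f(t,x,v)\neq0$, $$R(t,r,p_r)=\frac r{\phi(t)},\qquad P(t,r,p_r)=\phi(t)\,p_r-\dot\phi(t)\,r .$$ -/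

import Mathlib

open MeasureTheory Filter Topology

noncomputable section

/-- Euclidean three-space. -/
abbrev E3 : Type := EuclideanSpace ℝ (Fin 3)

/-- The charge density `ρ(x) = ∫ f(x, v) dv` of a phase-space function `f`. -/
def density (f : E3 → E3 → ℝ) (x : E3) : ℝ := ∫ v, f x v

/-- The gravitational potential `U_f(x) = -∫ ρ_f(y) / |y - x| dy`. -/
def potential (f : E3 → E3 → ℝ) (x : E3) : ℝ := -∫ y, density f y / ‖y - x‖

/-- The radial momentum `p_r = x · v / |x|`; it is only used for `x ≠ 0`. -/
def radialMomentum (x v : E3) : ℝ := inner ℝ x v / ‖x‖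

/-- The squared angular momentum `β = ℓ² = |x ∧ v|² = |x|² |v|² - (x · v)²`. -/
def angMomSq (x v : E3) : ℝ := ‖x‖ ^ 2 * ‖v‖ ^ 2 - (inner ℝ x v) ^ 2

/-- Invariance under the simultaneous action of `SO(3)` on `x` and `v`. -/
def SphericallySymmetric (g : E3 → E3 → ℝ) : Prop :=
  ∀ A : E3 ≃ₗᵢ[ℝ] E3, LinearMap.det (A.toLinearEquiv : E3 →ₗ[ℝ] E3) = 1 →
    ∀ x v, g (A x) (A v) = g x v

/-- Solutions `f ≥ 0` of the gravitational Vlasov-Poisson system on `ℝ × ℝ³ × ℝ³`. The integrals that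
define `ρ_f` and `U_f` converge; the Vlasov equation holds in the classical sense at all points of
`{f ≠ 0}` (as for the Kurth solutions, `f` may be singular at the boundary of this set). -/
structure IsVPSolution (f : ℝ → E3 → E3 → ℝ) : Prop where
  nonneg : ∀ t x v, 0 ≤ f t x v
  integrable_slice : ∀ t, ∀ᵐ x, Integrable (fun v => f t x v)
  integrable_potential : ∀ t x, Integrable (fun y => density (f t) y / ‖y - x‖)
  differentiable : ∀ t x v, f t x v ≠ 0 →
    DifferentiableAt ℝ (fun z : ℝ × E3 × E3 => f z.1 z.2.1 z.2.2) (t, x, v)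
  differentiable_potential : ∀ t x v, f t x v ≠ 0 → DifferentiableAt ℝ (potential (f t)) x
  vlasov : ∀ t x v, f t x v ≠ 0 →
    deriv (fun s => f s x v) t + inner ℝ v (gradient (fun y => f t y v) x)
      - inner ℝ (gradient (potential (f t)) x) (gradient (fun w => f t x w) v) = 0

/-- `Q` is a spherically symmetric steady state of the form `Q = Q̃(e_Q, β)`, where
`e_Q(x, v) = |v|² / 2 + U_Q(x)` is the particle energy. -/
structure IsSteadyState (Qt : ℝ → ℝ → ℝ) (Q : E3 → E3 → ℝ) : Prop where
  solution : IsVPSolution (fun _ => Q)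
  symmetric : SphericallySymmetric Q
  form : ∀ x v, Q x v = Qt (‖v‖ ^ 2 / 2 + potential Q x) (angMomSq x v)

/-- The potential of a spherically symmetric `Q` as a function of the radius `r`. It is extended to
`r < 0` as an even function, so that derivatives at `r = 0` make sense. -/
def radialPotential (Q : E3 → E3 → ℝ) (r : ℝ) : ℝ :=
  potential Q (r • EuclideanSpace.single (0 : Fin 3) (1 : ℝ))

/-- The particle energy in spherically symmetric variables,
`e_Q(r, p_r, β) = p_r² / 2 + U_Q(r) + β / (2 r²)`. -/
def radialEnergy (Q : E3 → E3 → ℝ) (r p β : ℝ) : ℝ :=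
  p ^ 2 / 2 + radialPotential Q r + β / (2 * r ^ 2)

/-- The set of all `(r, p_r)` that occur in `{Q ≠ 0}`. -/
def reducedSupport (Q : E3 → E3 → ℝ) : Set (ℝ × ℝ) :=
  {z | ∃ x v, x ≠ 0 ∧ Q x v ≠ 0 ∧ z = (‖x‖, radialMomentum x v)}

end

/-! ### Isometries of three-space -/

/-! Write S for `reducedSupport Q`. Along the tangent line to a characteristic of the Vlasov
equation, f and β have zero derivative; since ∂_e Q̃ ≠ 0, so has the energy e_Q(R, P, β). With x =
(r, 0, 0), v = (p, q, 0), β = r²q² this is a polynomial identity of degree four in q, valid on an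
open set of q (`radial_vlasov`, `transport_coefficients`). The q⁴ coefficient says ∂_pR = 0, the q²
coefficient is P ∂_pP R³ = r³(∂_tR + p ∂_rR), and the constant term carries the forces.

The Hamiltonian evolution keeps the Jacobian equal to 1 (`jacobian_eq_one`), so ∂_rR ∂_pP = 1 and P
is locally affine in p. Comparing the q² identity at two momenta gives R³ = (r ∂_rR)³, hence locally
R = k(t) r and P = p/k + k' r/k² (`radial_deriv_radius`, `momentum_eq`). Connectedness of S extends
this to the full preimage of S under that linear map (`pullback_mem`). Any two such preimages at the
same time meet near r = 0, because S contains a box at the centre; so k and k' depend on t only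
(`slope_unique`). Put φ = 1/k.

Now f(t, x, v) = Q(x/φ, φv − φ'x), so the potential of f is a rescaled U_Q (`potential_of_scaling`),
and the constant term becomes φ'' r = U_Q'(r)(−1/φ² + 1/φ³) for all radii r in S. The variables
separate: a single radius yields the equation for φ, and a single time with φ ≠ 1 yields U_Q' = αr.
Such a time exists, since φ ≡ 1 would make f stationary.

All this concerns times at which some point is mapped into S. That every time is of this kind is a
continuation argument (`exists_mem_of_mem_closure`): energy conservation bounds φ above, and
monotonicity of R in r keeps φ away from 0. -/

theorem exists_unit_orthogonal (v : E3) : ∃ e : E3, ‖e‖ = 1 ∧ inner ℝ e v = 0 := by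
  have hne : (ℝ ∙ v)ᗮ ≠ ⊥ := by
    intro h
    have h1 := (ℝ ∙ v).finrank_add_finrank_orthogonal
    rw [h, finrank_bot, finrank_euclideanSpace_fin] at h1
    have h2 := finrank_span_le_card (R := ℝ) ({v} : Set E3)
    simp at h2
    omega
  obtain ⟨w, hw, hw0⟩ := Submodule.exists_mem_ne_zero_of_ne_bot hne
  have hwv : inner ℝ w v = 0 := by
    rw [real_inner_comm]
    exact Submodule.mem_orthogonal_singleton_iff_inner_right.1 hw
  refine ⟨‖w‖⁻¹ • w, ?_, ?_⟩
  · rw [norm_smul, norm_inv, norm_norm, inv_mul_cancel₀ (norm_ne_zero_iff.2 hw0)]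
  · rw [inner_smul_left, hwv, mul_zero]

theorem det_reflection_orthogonal_singleton {w : E3} (hw : w ≠ 0) :
    LinearMap.det ((ℝ ∙ w)ᗮ.reflection.toLinearEquiv : E3 →ₗ[ℝ] E3) = -1 := by
  have h := (ℝ ∙ w)ᗮ.det_reflection
  rw [Submodule.orthogonal_orthogonal, finrank_span_singleton hw, pow_one] at h
  exact h

theorem exists_rotation {x y : E3} (h : ‖x‖ = ‖y‖) :
    ∃ A : E3 ≃ₗᵢ[ℝ] E3, LinearMap.det (A.toLinearEquiv : E3 →ₗ[ℝ] E3) = 1 ∧ A x = y := by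
  by_cases hxy : x = y
  · refine ⟨LinearIsometryEquiv.refl ℝ E3, ?_, hxy⟩
    exact LinearMap.det_id
  obtain ⟨e, he, hey⟩ := exists_unit_orthogonal y
  have he0 : e ≠ 0 := by
    rintro rfl
    simp at he
  -- The first reflection sends x to y; the second fixes y and restores determinant 1.
  refine ⟨(ℝ ∙ (x - y))ᗮ.reflection.trans (ℝ ∙ e)ᗮ.reflection, ?_, ?_⟩
  · have h3 := LinearMap.det_comp ((ℝ ∙ e)ᗮ.reflection.toLinearEquiv : E3 →ₗ[ℝ] E3)
      ((ℝ ∙ (x - y))ᗮ.reflection.toLinearEquiv : E3 →ₗ[ℝ] E3)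
    rw [det_reflection_orthogonal_singleton he0,
      det_reflection_orthogonal_singleton (sub_ne_zero.2 hxy)] at h3
    rw [neg_mul_neg, one_mul] at h3
    exact h3
  · rw [LinearIsometryEquiv.trans_apply, Submodule.reflection_sub h]
    apply Submodule.reflection_mem_subspace_eq_self
    exact Submodule.mem_orthogonal_singleton_iff_inner_right.2 hey

/-! ### Symmetries of density and potential -/

theorem density_comp_isometry {g : E3 → E3 → ℝ} (A : E3 ≃ₗᵢ[ℝ] E3) {x : E3}
    (h : ∀ v, g (A x) (A v) = g x v) : density g (A x) = density g x := by
  unfold density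
  rw [← (A.measurePreserving).integral_comp A.toHomeomorph.measurableEmbedding (fun v => g (A x) v)]
  exact integral_congr_ae (Eventually.of_forall h)

theorem ae_ne_zero : ∀ᵐ x : E3, x ≠ 0 := by
  rw [ae_iff]
  simp

theorem potential_comp_isometry {g : E3 → E3 → ℝ} (A : E3 ≃ₗᵢ[ℝ] E3)
    (h : ∀ x, x ≠ 0 → ∀ v, g (A x) (A v) = g x v) (x : E3) :
    potential g (A x) = potential g x := by
  unfold potential
  rw [← (A.measurePreserving).integral_comp A.toHomeomorph.measurableEmbedding
    (fun y => density g y / ‖y - A x‖)]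
  congr 1
  refine integral_congr_ae ?_
  filter_upwards [ae_ne_zero] with y hy
  rw [density_comp_isometry A (h y hy), ← map_sub, A.norm_map]

/-- The reflection in the line through x fixes x and reverses w, so U is even along x + s w and its
derivative at s = 0 vanishes. -/
theorem inner_gradient_eq_zero_of_isometry {U : E3 → ℝ}
    (hU : ∀ A : E3 ≃ₗᵢ[ℝ] E3, ∀ x, U (A x) = U x) {x w : E3} (hd : DifferentiableAt ℝ U x)
    (hw : inner ℝ x w = 0) : inner ℝ (gradient U x) w = 0 := by
  have h1 : HasDerivAt (fun s : ℝ => U (x + s • w)) (inner ℝ (gradient U x) w) 0 := by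
    have hF : HasFDerivAt U (fderiv ℝ U x) (x + (0 : ℝ) • w) := by simpa using hd.hasFDerivAt
    have hl : HasDerivAt (fun s : ℝ => x + s • w) w 0 := by
      simpa using ((hasDerivAt_id (0 : ℝ)).smul_const w).const_add x
    have := hF.comp_hasDerivAt (0 : ℝ) hl
    rwa [← inner_gradient_left] at this
  have h2 : HasDerivAt (fun s : ℝ => U (x + s • w)) (-inner ℝ (gradient U x) w) 0 := by
    have h3 : (fun s : ℝ => U (x + s • w)) = (fun s : ℝ => U (x + s • w)) ∘ Neg.neg := by
      funext s
      have := hU (ℝ ∙ x).reflection (x + s • w)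
      rw [map_add, map_smul, Submodule.reflection_mem_subspace_eq_self
        (Submodule.mem_span_singleton_self x),
        Submodule.reflection_mem_subspace_orthogonalComplement_eq_neg
        (Submodule.mem_orthogonal_singleton_iff_inner_right.2 hw)] at this
      simp only [Function.comp, neg_smul, ← this, smul_neg]
    rw [h3]
    have h1' : HasDerivAt (fun s : ℝ => U (x + s • w)) (inner ℝ (gradient U x) w) (-0) := by
      rwa [neg_zero]
    simpa using h1'.comp (0 : ℝ) (hasDerivAt_neg (0 : ℝ))
  have := h1.unique h2
  linarith

/-! ### Scaling of the potential -/

theorem density_scaling {g : E3 → E3 → ℝ} {c d : ℝ} (hc : 0 < c) (x : E3) :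
    density (fun x v => g (c⁻¹ • x) (c • v - d • x)) x = (c ^ 3)⁻¹ * density g (c⁻¹ • x) := by
  unfold density
  have h1 := Measure.integral_comp_smul (volume : Measure E3)
    (fun v => g (c⁻¹ • x) (v - d • x)) c
  rw [h1, integral_sub_right_eq_self (fun v => g (c⁻¹ • x) v), finrank_euclideanSpace_fin,
    smul_eq_mul, abs_of_pos (by positivity)]

/-- The velocity shift disappears on integrating over v. The factor c⁻³ of the density cancels the
c³ of the substitution in y, and the kernel leaves c⁻¹. -/
theorem potential_scaling {g : E3 → E3 → ℝ} {c d : ℝ} (hc : 0 < c) (x : E3) :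
    potential (fun x v => g (c⁻¹ • x) (c • v - d • x)) x = c⁻¹ * potential g (c⁻¹ • x) := by
  unfold potential
  simp_rw [density_scaling hc]
  have h1 := Measure.integral_comp_smul (volume : Measure E3)
    (fun y => (c ^ 3)⁻¹ * density g y / ‖c • y - x‖) c⁻¹
  simp_rw [smul_smul, mul_inv_cancel₀ hc.ne', one_smul] at h1
  rw [h1, finrank_euclideanSpace_fin, smul_eq_mul, abs_of_pos (by positivity)]
  have h2 : ∀ y : E3, (c ^ 3)⁻¹ * density g y / ‖c • y - x‖
      = (c ^ 3)⁻¹ * c⁻¹ * (density g y / ‖y - c⁻¹ • x‖) := by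
    intro y
    have : c • y - x = c • (y - c⁻¹ • x) := by
      rw [smul_sub, smul_smul, mul_inv_cancel₀ hc.ne', one_smul]
    rw [this, norm_smul, Real.norm_of_nonneg hc.le]
    rw [div_eq_mul_inv, div_eq_mul_inv, mul_inv]
    ring
  simp_rw [h2]
  rw [integral_const_mul]
  field_simp

/-- The representation of f is only given for x ≠ 0; the potential does not notice the null set x =
0. -/
theorem potential_congr {g h : E3 → E3 → ℝ} (H : ∀ x, x ≠ 0 → ∀ v, g x v = h x v) :
    potential g = potential h := by
  funext x
  unfold potential
  congr 1
  refine integral_congr_ae ?_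
  filter_upwards [ae_ne_zero] with y hy
  unfold density
  simp_rw [H y hy]

/-! ### Coordinates in a plane of motion -/

/-- The point with coordinates `(a, b, 0)`. -/
def planar (a b : ℝ) : E3 := !₂[a, b, 0]

theorem inner_planar (a b c d : ℝ) : inner ℝ (planar a b) (planar c d) = a * c + b * d := by
  simp [planar, PiLp.inner_apply, Fin.sum_univ_three]
  ring

theorem norm_planar_sq (a b : ℝ) : ‖planar a b‖ ^ 2 = a ^ 2 + b ^ 2 := by
  rw [← real_inner_self_eq_norm_sq, inner_planar]
  ring

theorem norm_planar (a b : ℝ) : ‖planar a b‖ = √(a ^ 2 + b ^ 2) := by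
  rw [← norm_planar_sq, Real.sqrt_sq (norm_nonneg _)]

theorem norm_planar_zero {r : ℝ} (hr : 0 ≤ r) : ‖planar r 0‖ = r := by
  rw [norm_planar, zero_pow two_ne_zero, add_zero, Real.sqrt_sq hr]

theorem planar_add (a b c d : ℝ) : planar a b + planar c d = planar (a + c) (b + d) := by
  ext i
  fin_cases i <;> simp [planar]

theorem smul_planar (s a b : ℝ) : s • planar a b = planar (s * a) (s * b) := by
  ext i
  fin_cases i <;> simp [planar]

theorem smul_single_eq_planar (r : ℝ) :
    r • EuclideanSpace.single (0 : Fin 3) (1 : ℝ) = planar r 0 := by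
  ext i
  fin_cases i <;> simp [planar]

theorem planar_ne_zero {r : ℝ} (hr : 0 < r) : planar r 0 ≠ 0 := by
  rw [← norm_pos_iff, norm_planar_zero hr.le]
  exact hr

theorem continuous_planar : Continuous fun z : ℝ × ℝ => planar z.1 z.2 := by
  have : (fun z : ℝ × ℝ => planar z.1 z.2) = fun z : ℝ × ℝ =>
      z.1 • planar 1 0 + z.2 • planar 0 1 := by
    funext z
    rw [smul_planar, smul_planar, planar_add]
    simp
  rw [this]
  fun_prop

theorem radialPotential_eq (Q : E3 → E3 → ℝ) (r : ℝ) :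
    radialPotential Q r = potential Q (planar r 0) := by
  rw [radialPotential, smul_single_eq_planar]

theorem angMomSq_planar (a b c d : ℝ) :
    angMomSq (planar a b) (planar c d) = (a * d - b * c) ^ 2 := by
  rw [angMomSq, norm_planar_sq, norm_planar_sq, inner_planar]
  ring

theorem radialMomentum_planar {r : ℝ} (hr : 0 < r) (p q : ℝ) :
    radialMomentum (planar r 0) (planar p q) = p := by
  rw [radialMomentum, inner_planar, norm_planar_zero hr.le]
  field_simp
  ring

theorem angMomSq_nonneg (x v : E3) : 0 ≤ angMomSq x v := by
  have h := abs_real_inner_le_norm x v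
  have h2 := pow_le_pow_left₀ (abs_nonneg _) h 2
  rw [sq_abs, mul_pow] at h2
  rw [angMomSq]
  linarith

theorem norm_sq_eq_radial {x : E3} (hx : x ≠ 0) (v : E3) :
    ‖v‖ ^ 2 / 2 = radialMomentum x v ^ 2 / 2 + angMomSq x v / (2 * ‖x‖ ^ 2) := by
  have : ‖x‖ ≠ 0 := norm_ne_zero_iff.2 hx
  rw [radialMomentum, angMomSq]
  field_simp
  ring

/-! ### Steady states in radial variables -/

theorem IsVPSolution.isOpen_ne {f : ℝ → E3 → E3 → ℝ} (hf : IsVPSolution f) :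
    IsOpen {z : ℝ × E3 × E3 | f z.1 z.2.1 z.2.2 ≠ 0} := by
  rw [isOpen_iff_mem_nhds]
  rintro ⟨t, x, v⟩ h
  exact (hf.differentiable t x v h).continuousAt.eventually_ne h

section steady

variable {Qt : ℝ → ℝ → ℝ} {Q : E3 → E3 → ℝ}

theorem IsSteadyState.isOpen_ne (hQ : IsSteadyState Qt Q) :
    IsOpen {z : E3 × E3 | Q z.1 z.2 ≠ 0} :=
  hQ.solution.isOpen_ne.preimage (f := fun z : E3 × E3 => ((0 : ℝ), z)) (by fun_prop)

theorem IsSteadyState.potential_eq (hQ : IsSteadyState Qt Q) (x : E3) :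
    potential Q x = radialPotential Q ‖x‖ := by
  rw [radialPotential_eq]
  obtain ⟨A, hA, hAx⟩ := exists_rotation (norm_planar_zero (norm_nonneg x)).symm
  rw [← hAx]
  exact (potential_comp_isometry A (fun x _ v => hQ.symmetric A hA x v) x).symm

theorem IsSteadyState.radialPotential_neg (hQ : IsSteadyState Qt Q) (r : ℝ) :
    radialPotential Q (-r) = radialPotential Q r := by
  rw [radialPotential, neg_smul, hQ.potential_eq, norm_neg, ← hQ.potential_eq, radialPotential]

theorem IsSteadyState.eq_radial (hQ : IsSteadyState Qt Q) {x : E3} (hx : x ≠ 0) (v : E3) :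
    Q x v = Qt (radialEnergy Q ‖x‖ (radialMomentum x v) (angMomSq x v)) (angMomSq x v) := by
  rw [hQ.form, radialEnergy, norm_sq_eq_radial hx, hQ.potential_eq]
  congr 1
  ring

theorem IsSteadyState.eq_planar (hQ : IsSteadyState Qt Q) {r : ℝ} (hr : 0 < r) (p q : ℝ) :
    Q (planar r 0) (planar p q) = Qt (radialEnergy Q r p ((r * q) ^ 2)) ((r * q) ^ 2) := by
  rw [hQ.eq_radial (planar_ne_zero hr), radialMomentum_planar hr, norm_planar_zero hr.le,
    angMomSq_planar, zero_mul, sub_zero]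

theorem mem_reducedSupport_planar {r p q : ℝ} (hr : 0 < r)
    (h : Q (planar r 0) (planar p q) ≠ 0) : (r, p) ∈ reducedSupport Q :=
  ⟨_, _, planar_ne_zero hr, h, by rw [radialMomentum_planar hr, norm_planar_zero hr.le]⟩

theorem reducedSupport_pos {z : ℝ × ℝ} (hz : z ∈ reducedSupport Q) : 0 < z.1 := by
  obtain ⟨x, v, hx, -, rfl⟩ := hz
  exact norm_pos_iff.2 hx

/-- Every β ≥ 0 is realised at radius r by a tangential velocity √β / r, so nonvanishing of `Qt` at
a reduced energy always comes from a phase-space point. -/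
theorem IsSteadyState.mem_reducedSupport_of_ne (hQ : IsSteadyState Qt Q) {r p β : ℝ} (hr : 0 < r)
    (hβ : 0 ≤ β) (h : Qt (radialEnergy Q r p β) β ≠ 0) : (r, p) ∈ reducedSupport Q := by
  refine mem_reducedSupport_planar (q := √β / r) hr ?_
  have h2 : (r * (√β / r)) ^ 2 = β := by
    rw [mul_div_cancel₀ _ hr.ne', Real.sq_sqrt hβ]
  rwa [hQ.eq_planar hr, h2]

theorem IsSteadyState.exists_planar (hQ : IsSteadyState Qt Q) {z : ℝ × ℝ}
    (hz : z ∈ reducedSupport Q) : ∃ q, Q (planar z.1 0) (planar z.2 q) ≠ 0 := by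
  obtain ⟨x, v, hx, h, rfl⟩ := hz
  have hr : 0 < ‖x‖ := norm_pos_iff.2 hx
  refine ⟨√(angMomSq x v) / ‖x‖, ?_⟩
  have h2 : (‖x‖ * (√(angMomSq x v) / ‖x‖)) ^ 2 = angMomSq x v := by
    rw [mul_div_cancel₀ _ hr.ne', Real.sq_sqrt (angMomSq_nonneg x v)]
  rw [hQ.eq_planar hr, h2, ← hQ.eq_radial hx]
  exact h

theorem IsSteadyState.isOpen_reducedSupport (hQ : IsSteadyState Qt Q) :
    IsOpen (reducedSupport Q) := by
  rw [isOpen_iff_mem_nhds]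
  intro z hz
  obtain ⟨q, hq⟩ := hQ.exists_planar hz
  have hc : Continuous fun z : ℝ × ℝ => (planar z.1 0, planar z.2 q) :=
    (continuous_planar.comp (by fun_prop : Continuous fun z : ℝ × ℝ => (z.1, (0 : ℝ)))).prodMk
      (continuous_planar.comp (by fun_prop : Continuous fun z : ℝ × ℝ => (z.2, q)))
  have h1 := (hQ.isOpen_ne.preimage hc).mem_nhds hq
  have h2 : ∀ᶠ y : ℝ × ℝ in 𝓝 z, 0 < y.1 :=
    continuousAt_fst.eventually_const_lt (reducedSupport_pos hz)
  filter_upwards [h1, h2] with y hy hy2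
  exact mem_reducedSupport_planar hy2 hy

theorem IsSteadyState.exists_box (hQ : IsSteadyState Qt Q) (hc : ∃ v, Q 0 v ≠ 0) :
    ∃ ε > 0, ∀ r p : ℝ, 0 < r → r < ε → |p| < ε → (r, p) ∈ reducedSupport Q := by
  obtain ⟨v, hv⟩ := hc
  obtain ⟨e, he, hev⟩ := exists_unit_orthogonal v
  obtain ⟨ε, hε, hball⟩ := Metric.isOpen_iff.1 hQ.isOpen_ne (0, v) hv
  -- Since e ⊥ v, the point (r e, v + p e) has radius r and radial momentum exactly p, and it lies
  -- close to (0, v).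
  refine ⟨ε, hε, fun r p hr hrε hp => ⟨r • e, v + p • e, ?_, ?_, ?_⟩⟩
  · rw [← norm_pos_iff, norm_smul, he, Real.norm_of_nonneg hr.le]
    linarith
  · suffices hm : (r • e, v + p • e) ∈ Metric.ball ((0 : E3), v) ε from hball hm
    rw [Metric.mem_ball, Prod.dist_eq, max_lt_iff]
    constructor
    · simpa [norm_smul, he, abs_of_pos hr] using hrε
    · simpa [norm_smul, he] using hp
  · have hn : ‖r • e‖ = r := by rw [norm_smul, he, Real.norm_of_nonneg hr.le, mul_one]
    rw [radialMomentum, hn, inner_add_right, inner_smul_left, inner_smul_left, inner_smul_right, hev,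
      real_inner_self_eq_norm_sq, he]
    ext
    · rfl
    · simp
      field_simp

theorem hasDerivAt_radial {U : E3 → ℝ} {r : ℝ} (h : DifferentiableAt ℝ U (planar r 0)) :
    HasDerivAt (fun s => U (planar s 0)) (inner ℝ (gradient U (planar r 0)) (planar 1 0)) r := by
  have hl : HasDerivAt (fun s : ℝ => planar s 0) (planar 1 0) r := by
    have h2 := (hasDerivAt_id r).smul_const (planar 1 0)
    have h3 : (fun s : ℝ => planar s 0) = fun s : ℝ => id s • planar 1 0 := by
      funext s
      simp [smul_planar]
    rw [h3]
    simpa using h2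
  have := h.hasFDerivAt.comp_hasDerivAt r hl
  rwa [← inner_gradient_left] at this

theorem IsSteadyState.differentiableAt_radialPotential (hQ : IsSteadyState Qt Q) {z : ℝ × ℝ}
    (hz : z ∈ reducedSupport Q) : DifferentiableAt ℝ (radialPotential Q) z.1 := by
  obtain ⟨q, hq⟩ := hQ.exists_planar hz
  have h := hasDerivAt_radial (hQ.solution.differentiable_potential 0 _ _ hq)
  simp_rw [← radialPotential_eq] at h
  exact h.differentiableAt

end steady

/-! ### The Vlasov equation in radial variables -/

theorem gradient_eq_planar {U : E3 → ℝ} (hU : ∀ A : E3 ≃ₗᵢ[ℝ] E3, ∀ x, U (A x) = U x) {r : ℝ}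
    (hd : DifferentiableAt ℝ U (planar r 0)) :
    gradient U (planar r 0) = planar (deriv (fun s => U (planar s 0)) r) 0 := by
  have hg := (hasDerivAt_radial hd).deriv
  have h0 : planar 1 0 = EuclideanSpace.single (0 : Fin 3) (1 : ℝ) := by
    rw [← smul_single_eq_planar, one_smul]
  have h1 : inner ℝ (gradient U (planar r 0)) (EuclideanSpace.single (1 : Fin 3) (1 : ℝ)) = 0 :=
    inner_gradient_eq_zero_of_isometry hU hd (by simp [planar, EuclideanSpace.inner_single_right])
  have h2 : inner ℝ (gradient U (planar r 0)) (EuclideanSpace.single (2 : Fin 3) (1 : ℝ)) = 0 :=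
    inner_gradient_eq_zero_of_isometry hU hd (by simp [planar, EuclideanSpace.inner_single_right])
  rw [hg, h0]
  rw [EuclideanSpace.inner_single_right] at h1 h2 ⊢
  ext i
  fin_cases i
  · simp [planar]
  · simpa [planar] using h1
  · simpa [planar] using h2

theorem IsVPSolution.fderiv_apply_eq_zero {f : ℝ → E3 → E3 → ℝ} (hf : IsVPSolution f) {t : ℝ}
    {x v : E3} (h : f t x v ≠ 0) :
    fderiv ℝ (fun z : ℝ × E3 × E3 => f z.1 z.2.1 z.2.2) (t, x, v)
      (1, v, -gradient (potential (f t)) x) = 0 := by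
  have hv := hf.vlasov t x v h
  have hD := (hf.differentiable t x v h).hasFDerivAt
  set D := fderiv ℝ (fun z : ℝ × E3 × E3 => f z.1 z.2.1 z.2.2) (t, x, v)
  have e1 : deriv (fun s => f s x v) t = D (1, 0, 0) := by
    have hl : HasDerivAt (fun s : ℝ => (s, x, v)) (1, 0, 0) t :=
      (hasDerivAt_id t).prodMk ((hasDerivAt_const t x).prodMk (hasDerivAt_const t v))
    exact (hD.comp_hasDerivAt t hl).deriv
  have e2 : ∀ w, inner ℝ w (gradient (fun y => f t y v) x) = D (0, w, 0) := by
    intro w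
    have hl : HasFDerivAt (fun y : E3 => (t, y, v))
        ((0 : E3 →L[ℝ] ℝ).prod ((ContinuousLinearMap.id ℝ E3).prod 0)) x :=
      (hasFDerivAt_const t x).prodMk ((hasFDerivAt_id x).prodMk (hasFDerivAt_const v x))
    have h2 := HasFDerivAt.comp x hD hl
    have h3 : fderiv ℝ (fun y => f t y v) x = _ := h2.fderiv
    rw [real_inner_comm, inner_gradient_left, h3]
    rfl
  have e3 : ∀ w, inner ℝ w (gradient (fun y => f t x y) v) = D (0, 0, w) := by
    intro w
    have hl : HasFDerivAt (fun y : E3 => (t, x, y))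
        ((0 : E3 →L[ℝ] ℝ).prod ((0 : E3 →L[ℝ] E3).prod (ContinuousLinearMap.id ℝ E3))) v :=
      (hasFDerivAt_const t v).prodMk ((hasFDerivAt_const x v).prodMk (hasFDerivAt_id v))
    have h2 := HasFDerivAt.comp v hD hl
    have h3 : fderiv ℝ (fun y => f t x y) v = _ := h2.fderiv
    rw [real_inner_comm, inner_gradient_left, h3]
    rfl
  rw [e1, e2, e3] at hv
  have : ((1 : ℝ), v, -gradient (potential (f t)) x)
      = (1, 0, 0) + (0, v, 0) - (0, 0, gradient (potential (f t)) x) := by simp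
  rw [this, map_sub, map_add]
  exact hv

/-- The curve is the straight tangent to the characteristic through the point. A first-order
statement suffices, so no characteristic has to be constructed. -/
theorem IsVPSolution.hasDerivAt_along_curve {f : ℝ → E3 → E3 → ℝ} (hf : IsVPSolution f) {t : ℝ}
    (hU : ∀ A : E3 ≃ₗᵢ[ℝ] E3, ∀ x, potential (f t) (A x) = potential (f t) x) {r p q g : ℝ}
    (h : f t (planar r 0) (planar p q) ≠ 0)
    (hg : g = deriv (fun s => potential (f t) (planar s 0)) r) :
    HasDerivAt (fun s => f (t + s) (planar (r + s * p) (s * q)) (planar (p - s * g) q)) 0 0 := by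
  have h0 := hf.fderiv_apply_eq_zero h
  have hD := (hf.differentiable t _ _ h).hasFDerivAt
  rw [gradient_eq_planar hU (hf.differentiable_potential t _ _ h), ← hg] at h0
  have hl : HasDerivAt (fun s : ℝ => ((t, planar r 0, planar p q) : ℝ × E3 × E3)
      + s • ((1, planar p q, -planar g 0) : ℝ × E3 × E3))
      (1, planar p q, -planar g 0) 0 := by
    have h2 := ((hasDerivAt_id (0 : ℝ)).smul_const
      ((1, planar p q, -planar g 0) : ℝ × E3 × E3)).const_add
      ((t, planar r 0, planar p q) : ℝ × E3 × E3)
    rw [one_smul] at h2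
    exact h2
  have hD' : HasFDerivAt (fun z : ℝ × E3 × E3 => f z.1 z.2.1 z.2.2)
      (fderiv ℝ (fun z : ℝ × E3 × E3 => f z.1 z.2.1 z.2.2) (t, planar r 0, planar p q))
      ((t, planar r 0, planar p q) + (0 : ℝ) • ((1, planar p q, -planar g 0) : ℝ × E3 × E3)) := by
    simpa using hD
  have h1 := hD'.comp_hasDerivAt (0 : ℝ) hl
  rw [h0] at h1
  refine h1.congr_of_eventuallyEq (Eventually.of_forall fun s => ?_)
  have e : -planar g 0 = planar (-g) 0 := by
    rw [← neg_one_smul ℝ, smul_planar]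
    simp
  simp only [Function.comp, Prod.smul_mk, Prod.mk_add_mk, e, smul_planar, planar_add]
  simp [sub_eq_add_neg]

/-- Chain rule for `s ↦ F (t + s, r(s), p(s))`. -/
theorem hasDerivAt_comp_triple {F : ℝ × ℝ × ℝ → ℝ} {t : ℝ} {a b : ℝ → ℝ} {a' b' : ℝ}
    (hF : DifferentiableAt ℝ F (t, a 0, b 0)) (ha : HasDerivAt a a' 0) (hb : HasDerivAt b b' 0) :
    HasDerivAt (fun s => F (t + s, a s, b s))
      (fderiv ℝ F (t, a 0, b 0) (1, 0, 0) + a' * fderiv ℝ F (t, a 0, b 0) (0, 1, 0)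
        + b' * fderiv ℝ F (t, a 0, b 0) (0, 0, 1)) 0 := by
  have hl : HasDerivAt (fun s : ℝ => (t + s, a s, b s)) (1, a', b') 0 :=
    ((hasDerivAt_id (0 : ℝ)).const_add t).prodMk (ha.prodMk hb)
  have hF' : HasFDerivAt F (fderiv ℝ F (t, a 0, b 0)) (t + 0, a 0, b 0) := by
    simpa using hF.hasFDerivAt
  have h1 := hF'.comp_hasDerivAt (0 : ℝ) hl
  have e : ((1 : ℝ), a', b') = (1, 0, 0) + a' • (0, 1, 0) + b' • (0, 0, 1) := by simp
  rw [e, map_add, map_add, map_smul, map_smul, smul_eq_mul, smul_eq_mul] at h1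
  exact h1

/-- These are the radial equations of motion: q²/r is the centrifugal term, and angular momentum is
conserved to first order. -/
theorem radial_curve_derivs {r p q g : ℝ} (hr : 0 < r) :
    HasDerivAt (fun s => ‖planar (r + s * p) (s * q)‖) p 0 ∧
    HasDerivAt (fun s => radialMomentum (planar (r + s * p) (s * q)) (planar (p - s * g) q))
      (q ^ 2 / r - g) 0 ∧
    HasDerivAt (fun s => angMomSq (planar (r + s * p) (s * q)) (planar (p - s * g) q)) 0 0 := by
  have hs : HasDerivAt (fun s : ℝ => s) 1 0 := hasDerivAt_id 0
  have hx : HasDerivAt (fun s => r + s * p) p 0 := by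
    simpa using (hs.mul_const p).const_add r
  have hy : HasDerivAt (fun s => s * q) q 0 := by simpa using hs.mul_const q
  have hp : HasDerivAt (fun s => p - s * g) (-g) 0 := by
    simpa using (hs.mul_const g).const_sub p
  have hn : HasDerivAt (fun s => ‖planar (r + s * p) (s * q)‖) p 0 := by
    simp_rw [norm_planar]
    have h1 := ((hx.pow 2).add (hy.pow 2)).sqrt (by simp; positivity)
    refine h1.congr_deriv ?_
    simp [Real.sqrt_sq hr.le]
    field_simp
  refine ⟨hn, ?_, ?_⟩
  · simp_rw [radialMomentum, inner_planar]
    have h1 := (((hx.mul hp).add (hy.mul_const q))).div hn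
      (by simpa [norm_planar_zero hr.le] using hr.ne')
    refine h1.congr_deriv ?_
    simp [norm_planar_zero hr.le]
    field_simp
    ring
  · simp_rw [angMomSq_planar]
    have h1 := ((hx.mul_const q).sub (hy.mul hp)).pow 2
    refine h1.congr_deriv ?_
    simp [mul_comm]

/-- The transport equation for `f = Q̃(e_Q(R, P, β), β)` in radial variables. -/
theorem radial_vlasov {Qt : ℝ → ℝ → ℝ} {Q : E3 → E3 → ℝ} {f : ℝ → E3 → E3 → ℝ}
    {R P : ℝ × ℝ × ℝ → ℝ} (hQ : IsSteadyState Qt Q) (hf : IsVPSolution f)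
    (hform : ∀ t x v, x ≠ 0 →
      f t x v = Qt (radialEnergy Q (R (t, ‖x‖, radialMomentum x v))
        (P (t, ‖x‖, radialMomentum x v)) (angMomSq x v)) (angMomSq x v))
    (hQe : ∀ x v, Q x v ≠ 0 →
      DifferentiableWithinAt ℝ (fun w : ℝ × ℝ => Qt w.1 w.2) {w | 0 ≤ w.2}
        (‖v‖ ^ 2 / 2 + potential Q x, angMomSq x v) ∧
      deriv (fun e => Qt e (angMomSq x v)) (‖v‖ ^ 2 / 2 + potential Q x) ≠ 0)
    {t r p q g : ℝ} (hU : ∀ A : E3 ≃ₗᵢ[ℝ] E3, ∀ x, potential (f t) (A x) = potential (f t) x)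
    (hr : 0 < r) (h : f t (planar r 0) (planar p q) ≠ 0)
    (hg : g = deriv (fun s => potential (f t) (planar s 0)) r)
    (hR : DifferentiableAt ℝ R (t, r, p)) (hP : DifferentiableAt ℝ P (t, r, p))
    (hR0 : 0 < R (t, r, p)) :
    P (t, r, p) * (fderiv ℝ P (t, r, p) (1, 0, 0) + p * fderiv ℝ P (t, r, p) (0, 1, 0)
        + (q ^ 2 / r - g) * fderiv ℝ P (t, r, p) (0, 0, 1))
      + (deriv (radialPotential Q) (R (t, r, p)) - (r * q) ^ 2 / R (t, r, p) ^ 3)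
        * (fderiv ℝ R (t, r, p) (1, 0, 0) + p * fderiv ℝ R (t, r, p) (0, 1, 0)
        + (q ^ 2 / r - g) * fderiv ℝ R (t, r, p) (0, 0, 1)) = 0 := by
  obtain ⟨hn, hm, hb⟩ := radial_curve_derivs (p := p) (q := q) (g := g) hr
  have hn0 : ‖planar (r + 0 * p) (0 * q)‖ = r := by simp [norm_planar_zero hr.le]
  have hm0 : radialMomentum (planar (r + 0 * p) (0 * q)) (planar (p - 0 * g) q) = p := by
    simp [radialMomentum_planar hr]
  have hb0 : angMomSq (planar (r + 0 * p) (0 * q)) (planar (p - 0 * g) q) = (r * q) ^ 2 := by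
    simp [angMomSq_planar]
  have hRs := hasDerivAt_comp_triple (F := R) (t := t) (by rwa [hn0, hm0]) hn hm
  have hPs := hasDerivAt_comp_triple (F := P) (t := t) (by rwa [hn0, hm0]) hn hm
  simp only [hn0, hm0] at hRs hPs
  set DR := fderiv ℝ R (t, r, p) (1, 0, 0) + p * fderiv ℝ R (t, r, p) (0, 1, 0)
        + (q ^ 2 / r - g) * fderiv ℝ R (t, r, p) (0, 0, 1)
  set DP := fderiv ℝ P (t, r, p) (1, 0, 0) + p * fderiv ℝ P (t, r, p) (0, 1, 0)
        + (q ^ 2 / r - g) * fderiv ℝ P (t, r, p) (0, 0, 1)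
  set Rs : ℝ → ℝ := fun s => R (t + s, ‖planar (r + s * p) (s * q)‖,
    radialMomentum (planar (r + s * p) (s * q)) (planar (p - s * g) q)) with hRsdef
  set Ps : ℝ → ℝ := fun s => P (t + s, ‖planar (r + s * p) (s * q)‖,
    radialMomentum (planar (r + s * p) (s * q)) (planar (p - s * g) q)) with hPsdef
  set Bs : ℝ → ℝ := fun s => angMomSq (planar (r + s * p) (s * q)) (planar (p - s * g) q) with hBs
  have hRs0 : Rs 0 = R (t, r, p) := by simp only [hRsdef, hn0, hm0, add_zero]
  have hPs0 : Ps 0 = P (t, r, p) := by simp only [hPsdef, hn0, hm0, add_zero]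
  have hf0 : Qt (radialEnergy Q (R (t, r, p)) (P (t, r, p)) ((r * q) ^ 2)) ((r * q) ^ 2) ≠ 0 := by
    rw [hform t _ _ (planar_ne_zero hr), radialMomentum_planar hr, norm_planar_zero hr.le,
      angMomSq_planar, zero_mul, sub_zero] at h
    exact h
  have hS := hQ.mem_reducedSupport_of_ne hR0 (sq_nonneg _) hf0
  have hu := (hQ.differentiableAt_radialPotential hS).hasDerivAt
  -- This tangential velocity at radius R has the same β = (r q)², so hypothesis (a) can be used at
  -- the image point.
  set q' := r * q / R (t, r, p) with hq'
  have hRq : (R (t, r, p) * q') ^ 2 = (r * q) ^ 2 := by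
    rw [hq', mul_div_cancel₀ _ hR0.ne']
  have hQne : Q (planar (R (t, r, p)) 0) (planar (P (t, r, p)) q') ≠ 0 := by
    rw [hQ.eq_planar hR0, hRq]
    exact hf0
  have hQd := hQe _ _ hQne
  have hen : ‖planar (P (t, r, p)) q'‖ ^ 2 / 2 + potential Q (planar (R (t, r, p)) 0)
      = radialEnergy Q (R (t, r, p)) (P (t, r, p)) ((r * q) ^ 2) := by
    rw [norm_sq_eq_radial (planar_ne_zero hR0), radialMomentum_planar hR0, norm_planar_zero hR0.le,
      angMomSq_planar, zero_mul, sub_zero, hRq, ← radialPotential_eq, radialEnergy]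
    ring
  rw [hen, angMomSq_planar, zero_mul, sub_zero, hRq] at hQd
  obtain ⟨hQd1, hQd2⟩ := hQd
  have hE : HasDerivAt (fun s => radialEnergy Q (Rs s) (Ps s) (Bs s))
      (P (t, r, p) * DP
        + (deriv (radialPotential Q) (R (t, r, p)) - (r * q) ^ 2 / R (t, r, p) ^ 3) * DR) 0 := by
    unfold radialEnergy
    have hu' : HasDerivAt (radialPotential Q) (deriv (radialPotential Q) (R (t, r, p))) (Rs 0) := by
      rw [hRs0]
      exact hu
    have h1 := (((hPs.pow 2).div_const 2).add (hu'.comp 0 hRs)).add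
      (hb.div ((hRs.pow 2).const_mul 2) (by
        have : Rs 0 ≠ 0 := by rw [hRs0]; exact hR0.ne'
        simpa using this))
    refine h1.congr_deriv ?_
    have hB0 : Bs 0 = (r * q) ^ 2 := hb0
    simp only [Pi.pow_apply, hPs0, hRs0]
    rw [hB0]
    have := hR0.ne'
    simp
    field_simp
    ring
  set E' := P (t, r, p) * DP
        + (deriv (radialPotential Q) (R (t, r, p)) - (r * q) ^ 2 / R (t, r, p) ^ 3) * DR
  set D := fderivWithin ℝ (fun w : ℝ × ℝ => Qt w.1 w.2) {w | 0 ≤ w.2}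
    (radialEnergy Q (R (t, r, p)) (P (t, r, p)) ((r * q) ^ 2), (r * q) ^ 2)
  -- `Qt` is differentiable only within β ≥ 0. Both curves composed with it below stay in that
  -- half-plane for all parameters, which gives two-sided derivatives even at β = 0.
  have hD := hQd1.hasFDerivWithinAt
  have hde : HasDerivAt (fun e => Qt e ((r * q) ^ 2)) (D (1, 0))
      (radialEnergy Q (R (t, r, p)) (P (t, r, p)) ((r * q) ^ 2)) := by
    have hl : HasDerivAt (fun e : ℝ => (e, (r * q) ^ 2)) (1, 0)
      (radialEnergy Q (R (t, r, p)) (P (t, r, p)) ((r * q) ^ 2)) :=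
      (hasDerivAt_id _).prodMk (hasDerivAt_const _ _)
    have h1 := hD.comp_hasDerivWithinAt (s := Set.univ)
      (radialEnergy Q (R (t, r, p)) (P (t, r, p)) ((r * q) ^ 2)) hl.hasDerivWithinAt
      (fun e _ => sq_nonneg (r * q))
    exact hasDerivWithinAt_univ.1 h1
  have hcurve : HasDerivAt (fun s => Qt (radialEnergy Q (Rs s) (Ps s) (Bs s)) (Bs s))
      (D (E', 0)) 0 := by
    have hl : HasDerivAt (fun s => (radialEnergy Q (Rs s) (Ps s) (Bs s), Bs s)) (E', 0) 0 :=
      hE.prodMk hb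
    have hD0 : HasFDerivWithinAt (fun w : ℝ × ℝ => Qt w.1 w.2) D {w | 0 ≤ w.2}
        (radialEnergy Q (Rs 0) (Ps 0) (Bs 0), Bs 0) := by
      have hB0 : Bs 0 = (r * q) ^ 2 := hb0
      rw [hRs0, hPs0, hB0]
      exact hD
    have h1 := hD0.comp_hasDerivWithinAt (s := Set.univ) 0 hl.hasDerivWithinAt
      (fun s _ => angMomSq_nonneg _ _)
    exact hasDerivWithinAt_univ.1 h1
  have hz := hf.hasDerivAt_along_curve hU h hg
  have heq : (fun s => f (t + s) (planar (r + s * p) (s * q)) (planar (p - s * g) q))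
      =ᶠ[𝓝 0] fun s => Qt (radialEnergy Q (Rs s) (Ps s) (Bs s)) (Bs s) := by
    have hc : ContinuousAt (fun s => ‖planar (r + s * p) (s * q)‖) 0 := hn.continuousAt
    have : ∀ᶠ s in 𝓝 (0 : ℝ), 0 < ‖planar (r + s * p) (s * q)‖ :=
      hc.eventually_const_lt (hr.trans_eq hn0.symm)
    filter_upwards [this] with s hs
    exact hform _ _ _ (norm_pos_iff.1 hs)
  have h0 : D (E', 0) = 0 := (hcurve.unique (heq.hasDerivAt_iff.1 hz))
  have h1 : D (E', 0) = E' * D (1, 0) := by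
    have : (E', (0 : ℝ)) = E' • ((1 : ℝ), (0 : ℝ)) := by simp
    rw [this, map_smul, smul_eq_mul]
  rw [hde.deriv] at hQd2
  rw [h1] at h0
  exact (mul_eq_zero.1 h0).resolve_right hQd2

/-! ### Calculus for functions of `(t, r, p)` -/

theorem hasDerivAt_fderiv_apply {E : Type*} [NormedAddCommGroup E] [NormedSpace ℝ E]
    {F : E → ℝ} {γ : ℝ → E} {γ' b : E} {s : ℝ} (hF : ContDiffAt ℝ 2 F (γ s))
    (hγ : HasDerivAt γ γ' s) :
    HasDerivAt (fun s => fderiv ℝ F (γ s) b) (fderiv ℝ (fderiv ℝ F) (γ s) γ' b) s := by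
  have h1 : DifferentiableAt ℝ (fderiv ℝ F) (γ s) :=
    (hF.fderiv_right (m := 1) (by norm_num)).differentiableAt (by norm_num)
  have h2 := h1.hasFDerivAt.comp_hasDerivAt s hγ
  exact (h2.clm_apply (hasDerivAt_const s b)).congr_deriv (by simp)

theorem fderiv_fderiv_comm {E : Type*} [NormedAddCommGroup E] [NormedSpace ℝ E]
    {F : E → ℝ} {z : E} (hF : ContDiffAt ℝ 2 F z) (a b : E) :
    fderiv ℝ (fderiv ℝ F) z a b = fderiv ℝ (fderiv ℝ F) z b a :=
  hF.isSymmSndFDerivAt (by simp) a b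

section partials

variable {F : ℝ × ℝ × ℝ → ℝ} {t r p : ℝ}

theorem hasDerivAt_line_time : HasDerivAt (fun s : ℝ => (s, r, p)) (1, 0, 0) t :=
  (hasDerivAt_id t).prodMk (hasDerivAt_const t (r, p))

theorem hasDerivAt_line_radius : HasDerivAt (fun s : ℝ => (t, s, p)) (0, 1, 0) r :=
  (hasDerivAt_const r t).prodMk ((hasDerivAt_id r).prodMk (hasDerivAt_const r p))

theorem hasDerivAt_line_momentum : HasDerivAt (fun s : ℝ => (t, r, s)) (0, 0, 1) p :=
  (hasDerivAt_const p t).prodMk ((hasDerivAt_const p r).prodMk (hasDerivAt_id p))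

theorem hasDerivAt_time (hF : DifferentiableAt ℝ F (t, r, p)) :
    HasDerivAt (fun s => F (s, r, p)) (fderiv ℝ F (t, r, p) (1, 0, 0)) t :=
  HasFDerivAt.comp_hasDerivAt (f := fun s : ℝ => (s, r, p)) t hF.hasFDerivAt hasDerivAt_line_time

theorem hasDerivAt_radius (hF : DifferentiableAt ℝ F (t, r, p)) :
    HasDerivAt (fun s => F (t, s, p)) (fderiv ℝ F (t, r, p) (0, 1, 0)) r :=
  HasFDerivAt.comp_hasDerivAt (f := fun s : ℝ => (t, s, p)) r hF.hasFDerivAt hasDerivAt_line_radius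

theorem hasDerivAt_momentum (hF : DifferentiableAt ℝ F (t, r, p)) :
    HasDerivAt (fun s => F (t, r, s)) (fderiv ℝ F (t, r, p) (0, 0, 1)) p :=
  HasFDerivAt.comp_hasDerivAt (f := fun s : ℝ => (t, r, s)) p hF.hasFDerivAt
    hasDerivAt_line_momentum

end partials

theorem isOpen_radius_pos : IsOpen {z : ℝ × ℝ × ℝ | 0 < z.2.1} :=
  isOpen_lt continuous_const (by fun_prop)

theorem coeffs_eq_zero_of_eventually {a b c q₀ : ℝ}
    (h : ∀ᶠ q in 𝓝 q₀, a + b * q ^ 2 + c * q ^ 4 = 0) : a = 0 ∧ b = 0 ∧ c = 0 := by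
  have hp : (Polynomial.C a + Polynomial.C b * Polynomial.X ^ 2
      + Polynomial.C c * Polynomial.X ^ 4 : Polynomial ℝ) = 0 := by
    refine Polynomial.eq_zero_of_infinite_isRoot _ ((infinite_of_mem_nhds q₀ h).mono fun q hq => ?_)
    simpa [Polynomial.IsRoot] using hq
  refine ⟨?_, ?_, ?_⟩
  · simpa [Polynomial.coeff_X, Polynomial.coeff_C] using congr_arg (fun p => p.coeff 0) hp
  · simpa [Polynomial.coeff_X_pow, Polynomial.coeff_C] using congr_arg (fun p => p.coeff 2) hp
  · simpa [Polynomial.coeff_X_pow, Polynomial.coeff_C] using congr_arg (fun p => p.coeff 4) hp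

/-! ### Hamiltonian evolution preserves the Jacobian determinant -/

theorem strictMonoOn_of_deriv_pos_Ioi {ρ : ℝ → ℝ} (hd : ∀ r, 0 < r → 0 < deriv ρ r) :
    StrictMonoOn ρ (Set.Ioi 0) := by
  refine strictMonoOn_of_deriv_pos (convex_Ioi 0) (fun x hx => ?_) fun x hx => ?_
  · exact (differentiableAt_of_deriv_ne_zero (hd x hx).ne').continuousAt.continuousWithinAt
  · rw [interior_Ioi] at hx
    exact hd x hx

theorem tendsto_zero_of_tendsto_div {ρ : ℝ → ℝ} {s : ℝ}
    (hs : Tendsto (fun δ => ρ δ / δ) (𝓝[>] 0) (𝓝 s)) : Tendsto ρ (𝓝[>] 0) (𝓝 0) := by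
  have h1 : Tendsto (fun δ : ℝ => δ) (𝓝[>] 0) (𝓝 0) := nhdsWithin_le_nhds
  have h2 := hs.mul h1
  rw [mul_zero] at h2
  refine h2.congr' ?_
  filter_upwards [self_mem_nhdsWithin] with δ hδ
  exact div_mul_cancel₀ _ (ne_of_gt hδ)

/-- Convergence of ρ(δ)/δ forces ρ → 0 at the origin, and ρ is strictly increasing. -/
theorem radius_map_pos {ρ : ℝ → ℝ} {s : ℝ} (hd : ∀ r, 0 < r → 0 < deriv ρ r)
    (hs : Tendsto (fun δ => ρ δ / δ) (𝓝[>] 0) (𝓝 s)) {r : ℝ} (hr : 0 < r) : 0 < ρ r := by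
  have hmono := strictMonoOn_of_deriv_pos_Ioi hd
  have h2 : 0 < r / 2 := by positivity
  have h3 : 0 ≤ ρ (r / 2) := by
    refine le_of_tendsto (tendsto_zero_of_tendsto_div hs) ?_
    filter_upwards [Ioo_mem_nhdsGT h2] with δ hδ
    exact (hmono hδ.1 h2 hδ.2).le
  exact h3.trans_lt (hmono h2 hr (by linarith))

/-- Liouville's theorem. Mixed second derivatives of R and P commute, so the time derivatives of
their gradients are obtained by differentiating Hamilton's equations in r and p; the terms cancel by
symmetry of the Hessian of H. No regularity of H in t enters. -/
theorem jacobian_eq_one {R P : ℝ × ℝ × ℝ → ℝ} {H : ℝ → ℝ → ℝ → ℝ}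
    (hR : ContDiffOn ℝ 2 R {z | 0 < z.2.1}) (hP : ContDiffOn ℝ 2 P {z | 0 < z.2.1})
    (hH : ∀ t, ContDiffOn ℝ 2 (fun z : ℝ × ℝ => H t z.1 z.2) {z | 0 < z.1})
    (hRpos : ∀ z : ℝ × ℝ × ℝ, 0 < z.2.1 → 0 < R z)
    (hRt : ∀ t r p, 0 < r →
      HasDerivAt (fun s => R (s, r, p)) (deriv (fun q => H t (R (t, r, p)) q) (P (t, r, p))) t)
    (hPt : ∀ t r p, 0 < r →
      HasDerivAt (fun s => P (s, r, p)) (-deriv (fun q => H t q (P (t, r, p))) (R (t, r, p))) t)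
    {r p : ℝ} (hr : 0 < r)
    (hdet : fderiv ℝ R (0, r, p) (0, 1, 0) * fderiv ℝ P (0, r, p) (0, 0, 1)
      - fderiv ℝ R (0, r, p) (0, 0, 1) * fderiv ℝ P (0, r, p) (0, 1, 0) = 1) (t : ℝ) :
    fderiv ℝ R (t, r, p) (0, 1, 0) * fderiv ℝ P (t, r, p) (0, 0, 1)
      - fderiv ℝ R (t, r, p) (0, 0, 1) * fderiv ℝ P (t, r, p) (0, 1, 0) = 1 := by
  have hRc : ∀ z : ℝ × ℝ × ℝ, 0 < z.2.1 → ContDiffAt ℝ 2 R z := fun z hz =>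
    hR.contDiffAt (isOpen_radius_pos.mem_nhds hz)
  have hPc : ∀ z : ℝ × ℝ × ℝ, 0 < z.2.1 → ContDiffAt ℝ 2 P z := fun z hz =>
    hP.contDiffAt (isOpen_radius_pos.mem_nhds hz)
  have hRd : ∀ z : ℝ × ℝ × ℝ, 0 < z.2.1 → DifferentiableAt ℝ R z := fun z hz =>
    (hRc z hz).differentiableAt (by norm_num)
  have hPd : ∀ z : ℝ × ℝ × ℝ, 0 < z.2.1 → DifferentiableAt ℝ P z := fun z hz =>
    (hPc z hz).differentiableAt (by norm_num)
  have hHc : ∀ t, ∀ w : ℝ × ℝ, 0 < w.1 → ContDiffAt ℝ 2 (fun z : ℝ × ℝ => H t z.1 z.2) w :=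
    fun t w hw => (hH t).contDiffAt ((isOpen_lt continuous_const continuous_fst).mem_nhds hw)
  -- the time derivatives in terms of the differential of the Hamiltonian
  have hRt' : ∀ t r p, 0 < r → fderiv ℝ R (t, r, p) (1, 0, 0)
      = fderiv ℝ (fun z : ℝ × ℝ => H t z.1 z.2) (R (t, r, p), P (t, r, p)) (0, 1) := by
    intro t r p hr
    rw [(hasDerivAt_time (hRd (t, r, p) hr)).unique (hRt t r p hr)]
    have hl : HasDerivAt (fun q : ℝ => (R (t, r, p), q)) (0, 1) (P (t, r, p)) :=
      (hasDerivAt_const _ _).prodMk (hasDerivAt_id _)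
    exact (HasFDerivAt.comp_hasDerivAt (f := fun q : ℝ => (R (t, r, p), q)) (P (t, r, p))
      ((hHc t _ (hRpos _ hr)).differentiableAt (by norm_num)).hasFDerivAt hl).deriv
  have hPt' : ∀ t r p, 0 < r → fderiv ℝ P (t, r, p) (1, 0, 0)
      = -fderiv ℝ (fun z : ℝ × ℝ => H t z.1 z.2) (R (t, r, p), P (t, r, p)) (1, 0) := by
    intro t r p hr
    rw [(hasDerivAt_time (hPd (t, r, p) hr)).unique (hPt t r p hr)]
    have hl : HasDerivAt (fun q : ℝ => (q, P (t, r, p))) (1, 0) (R (t, r, p)) :=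
      (hasDerivAt_id _).prodMk (hasDerivAt_const _ _)
    exact congr_arg Neg.neg
      (HasFDerivAt.comp_hasDerivAt (f := fun q : ℝ => (q, P (t, r, p))) (R (t, r, p))
        ((hHc t _ (hRpos _ hr)).differentiableAt (by norm_num)).hasFDerivAt hl).deriv
  have key : ∀ s : ℝ, HasDerivAt (fun t => fderiv ℝ R (t, r, p) (0, 1, 0)
      * fderiv ℝ P (t, r, p) (0, 0, 1)
      - fderiv ℝ R (t, r, p) (0, 0, 1) * fderiv ℝ P (t, r, p) (0, 1, 0)) 0 s := by
    intro s
    set w : ℝ × ℝ := (R (s, r, p), P (s, r, p)) with hw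
    have hwc := hHc s w (hRpos (s, r, p) hr)
    set A := fderiv ℝ (fderiv ℝ (fun z : ℝ × ℝ => H s z.1 z.2)) w with hA
    have hAs : A (1, 0) (0, 1) = A (0, 1) (1, 0) := fderiv_fderiv_comm hwc _ _
    have hAe : ∀ a b : ℝ, ∀ c, A (a, b) c = a * A (1, 0) c + b * A (0, 1) c := by
      intro a b c
      have : (a, b) = a • ((1 : ℝ), (0 : ℝ)) + b • ((0 : ℝ), (1 : ℝ)) := by simp
      rw [this, map_add, map_smul, map_smul]
      rfl
    have hpos : ∀ᶠ q in 𝓝 r, 0 < q := lt_mem_nhds hr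
    have c1 := fderiv_fderiv_comm (hRc (s, r, p) hr) (1, 0, 0) (0, 1, 0)
    have c2 := fderiv_fderiv_comm (hRc (s, r, p) hr) (1, 0, 0) (0, 0, 1)
    have c3 := fderiv_fderiv_comm (hPc (s, r, p) hr) (1, 0, 0) (0, 1, 0)
    have c4 := fderiv_fderiv_comm (hPc (s, r, p) hr) (1, 0, 0) (0, 0, 1)
    have gr : HasDerivAt (fun q => (R (s, q, p), P (s, q, p)))
        (fderiv ℝ R (s, r, p) (0, 1, 0), fderiv ℝ P (s, r, p) (0, 1, 0)) r :=
      (hasDerivAt_radius (hRd (s, r, p) hr)).prodMk (hasDerivAt_radius (hPd (s, r, p) hr))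
    have gp : HasDerivAt (fun q => (R (s, r, q), P (s, r, q)))
        (fderiv ℝ R (s, r, p) (0, 0, 1), fderiv ℝ P (s, r, p) (0, 0, 1)) p :=
      (hasDerivAt_momentum (hRd (s, r, p) hr)).prodMk (hasDerivAt_momentum (hPd (s, r, p) hr))
    have d1 : fderiv ℝ (fderiv ℝ R) (s, r, p) (0, 1, 0) (1, 0, 0)
        = A (fderiv ℝ R (s, r, p) (0, 1, 0), fderiv ℝ P (s, r, p) (0, 1, 0)) (0, 1) := by
      refine (hasDerivAt_fderiv_apply (γ := fun q => (s, q, p)) (b := (1, 0, 0))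
        (hRc (s, r, p) hr) hasDerivAt_line_radius).unique
        ((hasDerivAt_fderiv_apply (γ := fun q => (R (s, q, p), P (s, q, p))) (b := (0, 1)) hwc gr).congr_of_eventuallyEq ?_)
      filter_upwards [hpos] with q hq using hRt' s q p hq
    have d2 : fderiv ℝ (fderiv ℝ R) (s, r, p) (0, 0, 1) (1, 0, 0)
        = A (fderiv ℝ R (s, r, p) (0, 0, 1), fderiv ℝ P (s, r, p) (0, 0, 1)) (0, 1) := by
      refine (hasDerivAt_fderiv_apply (γ := fun q => (s, r, q)) (b := (1, 0, 0))
        (hRc (s, r, p) hr) hasDerivAt_line_momentum).unique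
        ((hasDerivAt_fderiv_apply (γ := fun q => (R (s, r, q), P (s, r, q))) (b := (0, 1)) hwc gp).congr_of_eventuallyEq ?_)
      exact Eventually.of_forall fun q => hRt' s r q hr
    have d3 : fderiv ℝ (fderiv ℝ P) (s, r, p) (0, 1, 0) (1, 0, 0)
        = -A (fderiv ℝ R (s, r, p) (0, 1, 0), fderiv ℝ P (s, r, p) (0, 1, 0)) (1, 0) := by
      refine (hasDerivAt_fderiv_apply (γ := fun q => (s, q, p)) (b := (1, 0, 0))
        (hPc (s, r, p) hr) hasDerivAt_line_radius).unique
        ((hasDerivAt_fderiv_apply (γ := fun q => (R (s, q, p), P (s, q, p))) (b := (1, 0)) hwc gr).neg.congr_of_eventuallyEq ?_)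
      filter_upwards [hpos] with q hq using hPt' s q p hq
    have d4 : fderiv ℝ (fderiv ℝ P) (s, r, p) (0, 0, 1) (1, 0, 0)
        = -A (fderiv ℝ R (s, r, p) (0, 0, 1), fderiv ℝ P (s, r, p) (0, 0, 1)) (1, 0) := by
      refine (hasDerivAt_fderiv_apply (γ := fun q => (s, r, q)) (b := (1, 0, 0))
        (hPc (s, r, p) hr) hasDerivAt_line_momentum).unique
        ((hasDerivAt_fderiv_apply (γ := fun q => (R (s, r, q), P (s, r, q))) (b := (1, 0)) hwc gp).neg.congr_of_eventuallyEq ?_)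
      exact Eventually.of_forall fun q => hPt' s r q hr
    have e1 := hasDerivAt_fderiv_apply (γ := fun t : ℝ => (t, r, p)) (b := (0, 1, 0))
      (hRc (s, r, p) hr) hasDerivAt_line_time
    have e2 := hasDerivAt_fderiv_apply (γ := fun t : ℝ => (t, r, p)) (b := (0, 0, 1))
      (hRc (s, r, p) hr) hasDerivAt_line_time
    have e3 := hasDerivAt_fderiv_apply (γ := fun t : ℝ => (t, r, p)) (b := (0, 1, 0))
      (hPc (s, r, p) hr) hasDerivAt_line_time
    have e4 := hasDerivAt_fderiv_apply (γ := fun t : ℝ => (t, r, p)) (b := (0, 0, 1))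
      (hPc (s, r, p) hr) hasDerivAt_line_time
    refine ((e1.mul e4).sub (e2.mul e3)).congr_deriv ?_
    rw [c1, c2, c3, c4, d1, d2, d3, d4]
    rw [hAe (fderiv ℝ R (s, r, p) (0, 1, 0)) _ (0, 1), hAe (fderiv ℝ R (s, r, p) (0, 1, 0)) _ (1, 0),
      hAe (fderiv ℝ R (s, r, p) (0, 0, 1)) _ (0, 1), hAe (fderiv ℝ R (s, r, p) (0, 0, 1)) _ (1, 0), hAs]
    ring
  exact (is_const_of_deriv_eq_zero (fun s => (key s).differentiableAt)
    (fun s => (key s).deriv) t 0).trans hdet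

/-! ### Transformations whose radius does not depend on the radial momentum -/

/-- The points `(t, r, p)` which are mapped into `S`. -/
def liftedSupport (R P : ℝ × ℝ × ℝ → ℝ) (S : Set (ℝ × ℝ)) : Set (ℝ × ℝ × ℝ) :=
  {z | 0 < z.2.1 ∧ (R z, P z) ∈ S}

/-- A smooth family of area-preserving maps `(R, P)` which satisfies, over a connected open set `S`,
the two leading coefficients in `β` of the transport equation. -/
structure IsReducedTransport (R P : ℝ × ℝ × ℝ → ℝ) (S : Set (ℝ × ℝ)) : Prop where
  contDiffOn_radius : ContDiffOn ℝ 2 R {z | 0 < z.2.1}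
  contDiffOn_momentum : ContDiffOn ℝ 2 P {z | 0 < z.2.1}
  radius_pos : ∀ z : ℝ × ℝ × ℝ, 0 < z.2.1 → 0 < R z
  jacobian : ∀ z : ℝ × ℝ × ℝ, 0 < z.2.1 →
    fderiv ℝ R z (0, 1, 0) * fderiv ℝ P z (0, 0, 1)
      - fderiv ℝ R z (0, 0, 1) * fderiv ℝ P z (0, 1, 0) = 1
  isOpen : IsOpen S
  isPreconnected : IsPreconnected S
  pos : ∀ w ∈ S, 0 < w.1
  box : ∃ ε > 0, ∀ r p : ℝ, 0 < r → r < ε → |p| < ε → (r, p) ∈ S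
  momentum_deriv_radius : ∀ z ∈ liftedSupport R P S, fderiv ℝ R z (0, 0, 1) = 0
  transport : ∀ z ∈ liftedSupport R P S,
    P z * fderiv ℝ P z (0, 0, 1) * R z ^ 3
      = z.2.1 ^ 3 * (fderiv ℝ R z (1, 0, 0) + z.2.2 * fderiv ℝ R z (0, 1, 0))

namespace IsReducedTransport

variable {R P : ℝ × ℝ × ℝ → ℝ} {S : Set (ℝ × ℝ)}

theorem differentiableAt_radius (h : IsReducedTransport R P S) {z : ℝ × ℝ × ℝ} (hz : 0 < z.2.1) :
    DifferentiableAt ℝ R z :=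
  (h.contDiffOn_radius.contDiffAt (isOpen_radius_pos.mem_nhds hz)).differentiableAt (by norm_num)

theorem differentiableAt_momentum (h : IsReducedTransport R P S) {z : ℝ × ℝ × ℝ} (hz : 0 < z.2.1) :
    DifferentiableAt ℝ P z :=
  (h.contDiffOn_momentum.contDiffAt (isOpen_radius_pos.mem_nhds hz)).differentiableAt (by norm_num)

theorem isOpen_liftedSupport (h : IsReducedTransport R P S) : IsOpen (liftedSupport R P S) := by
  rw [isOpen_iff_mem_nhds]
  intro z hz
  have hc : ContinuousAt (fun z => (R z, P z)) z :=
    (h.differentiableAt_radius hz.1).continuousAt.prodMk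
      (h.differentiableAt_momentum hz.1).continuousAt
  filter_upwards [isOpen_radius_pos.mem_nhds hz.1,
    hc.preimage_mem_nhds (h.isOpen.mem_nhds hz.2)] with y h1 h2
  exact ⟨h1, h2⟩

theorem exists_ball (h : IsReducedTransport R P S) {z : ℝ × ℝ × ℝ}
    (hz : z ∈ liftedSupport R P S) : ∃ ε > 0, ∀ t r p, |t - z.1| < ε → |r - z.2.1| < ε →
      |p - z.2.2| < ε → (t, r, p) ∈ liftedSupport R P S := by
  obtain ⟨ε, hε, hb⟩ := Metric.isOpen_iff.1 h.isOpen_liftedSupport z hz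
  refine ⟨ε, hε, fun t r p h1 h2 h3 => hb ?_⟩
  rw [Metric.mem_ball, Prod.dist_eq, Prod.dist_eq, max_lt_iff, max_lt_iff]
  exact ⟨h1, h2, h3⟩

theorem eq_of_hasDerivAt_zero {F : ℝ → ℝ} {a ε x y : ℝ}
    (hF : ∀ s, |s - a| < ε → HasDerivAt F 0 s) (hx : |x - a| < ε) (hy : |y - a| < ε) :
    F x = F y := by
  have hm : ∀ s, s ∈ Metric.ball a ε ↔ |s - a| < ε := fun s => by
    rw [Metric.mem_ball, Real.dist_eq]
  refine Metric.isOpen_ball.is_const_of_deriv_eq_zero (convex_ball a ε).isPreconnected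
    (fun s hs => (hF s ((hm s).1 hs)).differentiableAt.differentiableWithinAt)
    (fun s hs => (hF s ((hm s).1 hs)).deriv) ((hm x).2 hx) ((hm y).2 hy)

/-- In a box inside the support, the radius map is independent of the momentum. -/
theorem radius_eq_of_box (h : IsReducedTransport R P S) {t₀ r₀ p₀ ε : ℝ}
    (hb : ∀ t r p, |t - t₀| < ε → |r - r₀| < ε → |p - p₀| < ε → (t, r, p) ∈ liftedSupport R P S)
    {t r p p' : ℝ} (ht : |t - t₀| < ε) (hr : |r - r₀| < ε) (hp : |p - p₀| < ε)
    (hp' : |p' - p₀| < ε) : R (t, r, p) = R (t, r, p') :=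
  eq_of_hasDerivAt_zero (F := fun s => R (t, r, s)) (fun s hs => by
    have hm := hb t r s ht hr hs
    rw [← h.momentum_deriv_radius _ hm]
    exact hasDerivAt_momentum (h.differentiableAt_radius hm.1)) hp hp'

theorem eventually_abs_sub_lt {a b ε : ℝ} (h : |a - b| < ε) : ∀ᶠ x in 𝓝 a, |x - b| < ε := by
  have : Continuous fun x : ℝ => |x - b| := by fun_prop
  exact this.continuousAt.eventually_lt_const h

/-- As R does not depend on p, a = ∂_rR does not either, and the Jacobian makes P affine in p with
slope 1/a. The p-dependent part of the transport identity then reads R³ = (r a)³. -/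
theorem radial_deriv_radius (h : IsReducedTransport R P S) {z : ℝ × ℝ × ℝ}
    (hz : z ∈ liftedSupport R P S) :
    fderiv ℝ R z (0, 1, 0) = R z / z.2.1 ∧ fderiv ℝ P z (0, 0, 1) = z.2.1 / R z := by
  obtain ⟨ε, hε, hb⟩ := h.exists_ball hz
  obtain ⟨t, r, p⟩ := z
  have ht : |t - t| < ε := by simpa
  have hr : |r - r| < ε := by simpa
  have hp : |p - p| < ε := by simpa
  -- the radial and time derivatives of the radius do not depend on the momentum
  have hRr : ∀ s, |s - p| < ε → fderiv ℝ R (t, r, s) (0, 1, 0) = fderiv ℝ R (t, r, p) (0, 1, 0) := by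
    intro s hs
    refine (hasDerivAt_radius (h.differentiableAt_radius (hb t r s ht hr hs).1)).unique
      ((hasDerivAt_radius (h.differentiableAt_radius hz.1)).congr_of_eventuallyEq ?_)
    filter_upwards [eventually_abs_sub_lt hr] with x hx
    exact h.radius_eq_of_box hb ht hx hs hp
  have hRt : ∀ s, |s - p| < ε → fderiv ℝ R (t, r, s) (1, 0, 0) = fderiv ℝ R (t, r, p) (1, 0, 0) := by
    intro s hs
    refine (hasDerivAt_time (h.differentiableAt_radius (hb t r s ht hr hs).1)).unique
      ((hasDerivAt_time (h.differentiableAt_radius hz.1)).congr_of_eventuallyEq ?_)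
    filter_upwards [eventually_abs_sub_lt ht] with x hx
    exact h.radius_eq_of_box hb hx hr hs hp
  set a := fderiv ℝ R (t, r, p) (0, 1, 0) with ha
  have hjac : ∀ s, |s - p| < ε → a * fderiv ℝ P (t, r, s) (0, 0, 1) = 1 := by
    intro s hs
    have hm := hb t r s ht hr hs
    have := h.jacobian _ hm.1
    rwa [h.momentum_deriv_radius _ hm, zero_mul, sub_zero, hRr s hs] at this
  have ha0 : a ≠ 0 := left_ne_zero_of_mul_eq_one (hjac p hp)
  have hPp : ∀ s, |s - p| < ε → fderiv ℝ P (t, r, s) (0, 0, 1) = 1 / a := by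
    intro s hs
    rw [eq_div_iff ha0, mul_comm]
    exact hjac s hs
  -- Any second momentum in the box would do.
  set s := p + ε / 2 with hsdef
  have hs : |s - p| < ε := by
    rw [hsdef, add_sub_cancel_left, abs_of_pos (by positivity)]
    linarith
  have hP : P (t, r, s) - s / a = P (t, r, p) - p / a := by
    refine eq_of_hasDerivAt_zero (F := fun s => P (t, r, s) - s / a) (fun x hx => ?_) hs hp
    have h1 := hasDerivAt_momentum (h.differentiableAt_momentum (hb t r x ht hr hx).1)
    refine (h1.sub ((hasDerivAt_id x).div_const a)).congr_deriv ?_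
    rw [hPp x hx, sub_self]
  have h1 := h.transport _ (hb t r s ht hr hs)
  have h2 := h.transport _ hz
  rw [hPp s hs, hRr s hs, hRt s hs, h.radius_eq_of_box hb ht hr hs hp] at h1
  rw [hPp p hp, ← ha] at h2
  simp only at h1 h2
  have hr0 : 0 < r := hz.1
  have hR0 : 0 < R (t, r, p) := h.radius_pos _ hz.1
  have h3 : R (t, r, p) ^ 3 = (r * a) ^ 3 := by
    have e1 : P (t, r, s) = P (t, r, p) + (s - p) / a := by
      rw [sub_div]
      linarith
    rw [e1] at h1
    have e2 : (s - p) * R (t, r, p) ^ 3 = (s - p) * (r * a) ^ 3 := by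
      field_simp at h1 h2
      linear_combination h1 - a * h2
    have e3 : s - p ≠ 0 := by
      rw [hsdef, add_sub_cancel_left]
      positivity
    exact mul_left_cancel₀ e3 e2
  have h4 : R (t, r, p) = r * a := (Odd.strictMono_pow (by decide : Odd 3)).injective h3
  refine ⟨?_, ?_⟩
  · rw [h4]
    field_simp
  · rw [hPp p hp, h4]
    field_simp

/-- R/r has zero radial derivative because ∂_rR = R/r. -/
theorem eventually_radius_eq (h : IsReducedTransport R P S) {t₀ r₀ p₀ : ℝ}
    (hz : (t₀, r₀, p₀) ∈ liftedSupport R P S) :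
    ∀ᶠ z : ℝ × ℝ × ℝ in 𝓝 (t₀, r₀, p₀), R z = R (z.1, r₀, p₀) / r₀ * z.2.1 := by
  obtain ⟨ε, hε, hb⟩ := h.exists_ball hz
  have hr₀ : |r₀ - r₀| < ε := by simpa
  have hp₀ : |p₀ - p₀| < ε := by simpa
  filter_upwards [Metric.ball_mem_nhds _ hε] with z hzb
  obtain ⟨t, r, p⟩ := z
  rw [Metric.mem_ball, Prod.dist_eq, Prod.dist_eq, max_lt_iff, max_lt_iff] at hzb
  obtain ⟨ht, hr, hp⟩ := hzb
  replace ht : |t - t₀| < ε := ht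
  replace hr : |r - r₀| < ε := hr
  have h0 : 0 < r := (hb t r p₀ ht hr hp₀).1
  have h1 : R (t, r, p₀) / r = R (t, r₀, p₀) / r₀ := by
    refine eq_of_hasDerivAt_zero (F := fun s => R (t, s, p₀) / s) (fun s hs => ?_) hr hr₀
    have hm := hb t s p₀ ht hs hp₀
    have hs0 : 0 < s := hm.1
    have h2 := hasDerivAt_radius (h.differentiableAt_radius hm.1)
    refine (h2.div (hasDerivAt_id s) hs0.ne').congr_deriv ?_
    rw [(h.radial_deriv_radius hm).1]
    simp
    field_simp
    simp
  rw [h.radius_eq_of_box hb ht hr hp hp₀, ← h1]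
  field_simp

theorem momentum_eq (h : IsReducedTransport R P S) {z : ℝ × ℝ × ℝ}
    (hz : z ∈ liftedSupport R P S) :
    P z = z.2.1 / R z * z.2.2
      + fderiv ℝ R z (1, 0, 0) / z.2.1 * (R z / z.2.1)⁻¹ ^ 2 * z.2.1 := by
  have h1 := h.transport z hz
  obtain ⟨h2, h3⟩ := h.radial_deriv_radius hz
  rw [h2, h3] at h1
  have hr0 : 0 < z.2.1 := hz.1
  have hR0 : 0 < R z := h.radius_pos _ hz.1
  field_simp at h1 ⊢
  linear_combination h1

theorem eventually_slope_eq (h : IsReducedTransport R P S) {z₀ : ℝ × ℝ × ℝ}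
    (hz : z₀ ∈ liftedSupport R P S) :
    ∀ᶠ z in 𝓝 z₀, z.1 = z₀.1 → R z / z.2.1 = R z₀ / z₀.2.1 ∧
      fderiv ℝ R z (1, 0, 0) / z.2.1 = fderiv ℝ R z₀ (1, 0, 0) / z₀.2.1 := by
  obtain ⟨t₀, r₀, p₀⟩ := z₀
  have h1 := h.eventually_radius_eq hz
  filter_upwards [h1.eventually_nhds, h.isOpen_liftedSupport.mem_nhds hz] with z hz1 hzW hzt
  obtain ⟨t, r, p⟩ := z
  obtain rfl : t = t₀ := hzt
  have hr0 : 0 < r := hzW.1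
  have hr₀ : 0 < r₀ := hz.1
  refine ⟨?_, ?_⟩
  · rw [hz1.self_of_nhds]
    field_simp
  · have e1 := hasDerivAt_time (h.differentiableAt_radius hzW.1)
    have e2 := ((hasDerivAt_time (h.differentiableAt_radius hz.1)).div_const r₀).mul_const r
    have hc : Tendsto (fun s : ℝ => (s, r, p)) (𝓝 t) (𝓝 (t, r, p)) :=
      hasDerivAt_line_time.continuousAt
    have e3 : (fun s => R (s, r, p)) =ᶠ[𝓝 t] fun s => R (s, r₀, p₀) / r₀ * r := hc.eventually hz1
    have e4 := e1.unique (e2.congr_of_eventuallyEq e3)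
    rw [e4]
    field_simp

/-- The inverse of the linear map `(r, p) ↦ (k r, p / k + m r / k²)`, at time `t`. -/
noncomputable def pullback (t k m : ℝ) (w : ℝ × ℝ) : ℝ × ℝ × ℝ := (t, w.1 / k, k * w.2 - m * w.1 / k ^ 2)

theorem continuous_pullback (t k m : ℝ) : Continuous (pullback t k m) := by
  unfold pullback
  fun_prop

theorem map_pullback (h : IsReducedTransport R P S) {t k m : ℝ} {w : ℝ × ℝ} (hk : 0 < k)
    (hw : pullback t k m w ∈ liftedSupport R P S)
    (h1 : R (pullback t k m w) / (pullback t k m w).2.1 = k)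
    (h2 : fderiv ℝ R (pullback t k m w) (1, 0, 0) / (pullback t k m w).2.1 = m) :
    R (pullback t k m w) = w.1 ∧ P (pullback t k m w) = w.2 := by
  have hr : 0 < (pullback t k m w).2.1 := hw.1
  have hR : R (pullback t k m w) = w.1 := by
    have h3 := h1
    rw [div_eq_iff hr.ne'] at h3
    rw [h3, pullback]
    field_simp
  have hw1 : 0 < w.1 := hR ▸ h.radius_pos _ hr
  refine ⟨hR, ?_⟩
  rw [h.momentum_eq hw, h2, h1, hR]
  simp only [pullback]
  field_simp
  ring

/-- The set of w in S whose linear preimage is a genuine preimage with the same slopes k and m is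
nonempty, open and relatively closed in S, hence all of S. -/
theorem pullback_mem (h : IsReducedTransport R P S) {z₁ : ℝ × ℝ × ℝ} {k m : ℝ}
    (hz : z₁ ∈ liftedSupport R P S) (hk : R z₁ / z₁.2.1 = k)
    (hm : fderiv ℝ R z₁ (1, 0, 0) / z₁.2.1 = m) {w : ℝ × ℝ} (hw : w ∈ S) :
    pullback z₁.1 k m w ∈ liftedSupport R P S ∧
      R (pullback z₁.1 k m w) / (pullback z₁.1 k m w).2.1 = k ∧
      fderiv ℝ R (pullback z₁.1 k m w) (1, 0, 0) / (pullback z₁.1 k m w).2.1 = m := by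
  have hr1 : 0 < z₁.2.1 := hz.1
  have hk0 : 0 < k := hk ▸ div_pos (h.radius_pos _ hr1) hr1
  set L := pullback z₁.1 k m with hL
  have hLc : Continuous L := continuous_pullback _ _ _
  set u : Set (ℝ × ℝ) := {w | L w ∈ liftedSupport R P S ∧ R (L w) / (L w).2.1 = k ∧
      fderiv ℝ R (L w) (1, 0, 0) / (L w).2.1 = m} with hu
  suffices hsub : S ⊆ u from hsub hw
  refine h.isPreconnected.subset_of_closure_inter_subset ?_ ?_ ?_
  · rw [isOpen_iff_mem_nhds]
    rintro w ⟨hw1, hw2, hw3⟩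
    filter_upwards [hLc.continuousAt.preimage_mem_nhds (h.isOpen_liftedSupport.mem_nhds hw1),
      hLc.continuousAt.eventually (h.eventually_slope_eq hw1)] with y hy1 hy2
    obtain ⟨hy3, hy4⟩ := hy2 rfl
    exact ⟨hy1, hy3.trans hw2, hy4.trans hw3⟩
  · refine ⟨(R z₁, P z₁), hz.2, ?_⟩
    have hR0 : 0 < R z₁ := h.radius_pos _ hr1
    have : L (R z₁, P z₁) = z₁ := by
      rw [hL, pullback]
      refine Prod.ext rfl (Prod.ext ?_ ?_)
      · simp only [← hk]
        field_simp
      · simp only [h.momentum_eq hz, hm, hk]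
        have : R z₁ = k * z₁.2.1 := by
          rw [← hk]
          field_simp
        rw [this]
        field_simp
        ring
    rw [hu, Set.mem_ofPred_eq, this]
    exact ⟨hz, hk, hm⟩
  -- Relative closedness: by continuity (R, P) maps the preimage of the limit point w to w itself.
  -- As w lies in S, that preimage is in the lifted support.
  · rintro w ⟨hwc, hwS⟩
    have hw0 : 0 < w.1 := h.pos w hwS
    have hpos : 0 < (L w).2.1 := div_pos hw0 hk0
    have hRc := (h.differentiableAt_radius hpos).continuousAt
    have hPc := (h.differentiableAt_momentum hpos).continuousAt
    have hDc : ContinuousAt (fun z => fderiv ℝ R z (1, 0, 0)) (L w) := by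
      have h1 := (h.contDiffOn_radius.contDiffAt (isOpen_radius_pos.mem_nhds hpos)).fderiv_right
        (m := 1) (by norm_num)
      exact h1.continuousAt.clm_apply continuousAt_const
    have hne : (𝓝[u] w).NeBot := mem_closure_iff_nhdsWithin_neBot.1 hwc
    have hLu : Tendsto L (𝓝[u] w) (𝓝 (L w)) := hLc.continuousAt.tendsto.mono_left nhdsWithin_le_nhds
    have hmem : ∀ᶠ y in 𝓝[u] w, y ∈ u := self_mem_nhdsWithin
    have hid : Tendsto (fun y : ℝ × ℝ => y) (𝓝[u] w) (𝓝 w) := nhdsWithin_le_nhds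
    have hRw : R (L w) = w.1 := by
      refine tendsto_nhds_unique (hRc.tendsto.comp hLu)
        (((continuous_fst.tendsto w).comp hid).congr' ?_)
      filter_upwards [hmem] with y hy
      exact (h.map_pullback hk0 hy.1 hy.2.1 hy.2.2).1.symm
    have hPw : P (L w) = w.2 := by
      refine tendsto_nhds_unique (hPc.tendsto.comp hLu)
        (((continuous_snd.tendsto w).comp hid).congr' ?_)
      filter_upwards [hmem] with y hy
      exact (h.map_pullback hk0 hy.1 hy.2.1 hy.2.2).2.symm
    have hr : ContinuousAt (fun z : ℝ × ℝ × ℝ => z.2.1) (L w) := by fun_prop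
    refine ⟨⟨hpos, ?_⟩, ?_, ?_⟩
    · rw [hRw, hPw]
      exact hwS
    · refine tendsto_nhds_unique ((hRc.div hr hpos.ne').tendsto.comp hLu)
        (tendsto_const_nhds.congr' ?_)
      filter_upwards [hmem] with y hy
      exact hy.2.1.symm
    · refine tendsto_nhds_unique ((hDc.div hr hpos.ne').tendsto.comp hLu)
        (tendsto_const_nhds.congr' ?_)
      filter_upwards [hmem] with y hy
      exact hy.2.2.symm

/-- Whatever k > 0 and m are, the preimage of S contains (t, δ, 0) for all small δ > 0. These common
points link preimages with a priori different slopes. -/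
theorem eventually_axis_mem (h : IsReducedTransport R P S) {t k m : ℝ} (hk0 : 0 < k) :
    ∀ᶠ δ in 𝓝[>] (0 : ℝ), (k * δ, m * δ / k ^ 2) ∈ S ∧
      pullback t k m (k * δ, m * δ / k ^ 2) = (t, δ, 0) := by
  obtain ⟨ε, hε, hbox⟩ := h.box
  have h1 : ContinuousAt (fun δ : ℝ => k * δ) 0 := by fun_prop
  have h2 : ContinuousAt (fun δ : ℝ => |m * δ / k ^ 2|) 0 := by fun_prop
  have e1 := h1.eventually_lt_const (u := ε) (by simpa using hε)
  have e2 := h2.eventually_lt_const (u := ε) (by simpa using hε)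
  filter_upwards [self_mem_nhdsWithin, nhdsWithin_le_nhds e1, nhdsWithin_le_nhds e2] with δ hδ h3 h4
  refine ⟨hbox _ _ (mul_pos hk0 hδ) h3 h4, ?_⟩
  rw [pullback]
  refine Prod.ext rfl (Prod.ext ?_ ?_)
  · simp only
    field_simp
  · simp only
    field_simp
    ring

theorem slope_unique (h : IsReducedTransport R P S) {z₁ z₂ : ℝ × ℝ × ℝ}
    (hz₁ : z₁ ∈ liftedSupport R P S) (hz₂ : z₂ ∈ liftedSupport R P S) (ht : z₁.1 = z₂.1) :
    R z₁ / z₁.2.1 = R z₂ / z₂.2.1 ∧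
      fderiv ℝ R z₁ (1, 0, 0) / z₁.2.1 = fderiv ℝ R z₂ (1, 0, 0) / z₂.2.1 := by
  have hk : ∀ z ∈ liftedSupport R P S, 0 < R z / z.2.1 := fun z hz =>
    div_pos (h.radius_pos z hz.1) hz.1
  obtain ⟨δ, ⟨h1, h2⟩, h3, h4⟩ := ((h.eventually_axis_mem (t := z₁.1)
    (m := fderiv ℝ R z₁ (1, 0, 0) / z₁.2.1) (hk z₁ hz₁)).and (h.eventually_axis_mem (t := z₂.1)
    (m := fderiv ℝ R z₂ (1, 0, 0) / z₂.2.1) (hk z₂ hz₂))).exists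
  obtain ⟨-, a1, a2⟩ := h.pullback_mem hz₁ rfl rfl h1
  obtain ⟨-, b1, b2⟩ := h.pullback_mem hz₂ rfl rfl h3
  rw [h2] at a1 a2
  rw [h4, ← ht] at b1 b2
  exact ⟨a1.symm.trans b1, a2.symm.trans b2⟩

/-- Over each time at which the support is nonempty, the transformation is the linear map
`(r, p) ↦ (r / φ, φ p - φ' r)`, and its image is all of `S`. -/
theorem exists_scaling (h : IsReducedTransport R P S) :
    ∃ φ φ' φ'' : ℝ → ℝ, ∀ t, (∃ z ∈ liftedSupport R P S, z.1 = t) →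
      0 < φ t ∧ HasDerivAt φ (φ' t) t ∧ HasDerivAt φ' (φ'' t) t ∧
      (∀ r p, (t, r, p) ∈ liftedSupport R P S →
        R (t, r, p) = r / φ t ∧ P (t, r, p) = φ t * p - φ' t * r) ∧
      ∀ w ∈ S, (t, φ t * w.1, w.2 / φ t + φ' t * w.1) ∈ liftedSupport R P S := by
  have hex : ∀ t : ℝ, ∃ k m : ℝ, ∀ z ∈ liftedSupport R P S, z.1 = t → R z / z.2.1 = k ∧
      fderiv ℝ R z (1, 0, 0) / z.2.1 = m := by
    intro t
    by_cases ht : ∃ z ∈ liftedSupport R P S, z.1 = t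
    · obtain ⟨z, hz, rfl⟩ := ht
      exact ⟨_, _, fun y hy hyt => h.slope_unique hy hz hyt⟩
    -- At times with empty support the values are arbitrary.
    · push Not at ht
      exact ⟨0, 0, fun z hz hzt => absurd hzt (ht z hz)⟩
  choose K M hKM using hex
  have key : ∀ t, (∃ z ∈ liftedSupport R P S, z.1 = t) → 0 < K t ∧ HasDerivAt K (M t) t ∧
      DifferentiableAt ℝ M t := by
    rintro t ⟨⟨t', r, p⟩, hz, ht⟩
    obtain rfl : t' = t := ht
    have hr : 0 < r := hz.1
    obtain ⟨hK, hM⟩ := hKM t' _ hz rfl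
    have hc : Tendsto (fun s : ℝ => (s, r, p)) (𝓝 t') (𝓝 (t', r, p)) :=
      hasDerivAt_line_time.continuousAt
    have hW := hc.eventually (h.isOpen_liftedSupport.mem_nhds hz)
    refine ⟨hK ▸ div_pos (h.radius_pos _ hz.1) hz.1, ?_, ?_⟩
    · rw [← hM]
      refine ((hasDerivAt_time (h.differentiableAt_radius hz.1)).div_const
        r).congr_of_eventuallyEq ?_
      filter_upwards [hW] with s hs
      exact (hKM s _ hs rfl).1.symm
    · have h1 := hasDerivAt_fderiv_apply (γ := fun s : ℝ => (s, r, p)) (b := (1, 0, 0))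
        (h.contDiffOn_radius.contDiffAt (isOpen_radius_pos.mem_nhds hz.1)) hasDerivAt_line_time
      refine ((h1.div_const r).congr_of_eventuallyEq ?_).differentiableAt
      filter_upwards [hW] with s hs
      exact (hKM s _ hs rfl).2.symm
  refine ⟨fun t => (K t)⁻¹, fun t => -M t / K t ^ 2, deriv fun t => -M t / K t ^ 2, ?_⟩
  intro t ht
  obtain ⟨hK, hKd, hMd⟩ := key t ht
  refine ⟨inv_pos.2 hK, hKd.fun_inv hK.ne', ?_, ?_, ?_⟩
  · exact ((hMd.neg).div (hKd.differentiableAt.pow 2) (pow_ne_zero 2 hK.ne')).hasDerivAt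
  · intro r p hz
    have hr : 0 < r := hz.1
    obtain ⟨h1, h2⟩ := hKM t _ hz rfl
    have h3 := h.momentum_eq hz
    have h4 : R (t, r, p) = K t * r := by
      rw [← h1]
      field_simp
    refine ⟨by rw [h4]; field_simp, ?_⟩
    rw [h3, h2, h1, h4]
    field_simp
    ring
  · intro w hw
    obtain ⟨z, hz, rfl⟩ := ht
    obtain ⟨h1, h2⟩ := hKM z.1 z hz rfl
    have h3 := (h.pullback_mem hz h1 h2 hw).1
    have e : pullback z.1 (K z.1) (M z.1) w = (z.1, (K z.1)⁻¹ * w.1,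
        w.2 / (K z.1)⁻¹ + -M z.1 / K z.1 ^ 2 * w.1) := by
      rw [pullback]
      refine Prod.ext rfl (Prod.ext ?_ ?_)
      · simp only
        field_simp
      · simp only
        field_simp
        ring
    rwa [e] at h3

end IsReducedTransport

/-! ### Global existence of the scaling factor -/

section scalingFactor

variable {α : ℝ} {φ φ' φ'' : ℝ → ℝ} {J : Set ℝ}

theorem scaling_energy_const (hJ : IsOpen J) (hJc : IsPreconnected J)
    (hφ : ∀ t ∈ J, 0 < φ t ∧ HasDerivAt φ (φ' t) t ∧ HasDerivAt φ' (φ'' t) t ∧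
      φ'' t = α * (-(1 / φ t ^ 2) + 1 / φ t ^ 3)) {s t : ℝ} (hs : s ∈ J) (ht : t ∈ J) :
    φ' t ^ 2 / 2 - α / φ t + α / (2 * φ t ^ 2) = φ' s ^ 2 / 2 - α / φ s + α / (2 * φ s ^ 2) := by
  have key : ∀ x ∈ J, HasDerivAt
      (fun t => φ' t ^ 2 / 2 - α / φ t + α / (2 * φ t ^ 2)) 0 x := by
    intro x hx
    obtain ⟨h0, h1, h2, h3⟩ := hφ x hx
    have e1 := (h2.pow 2).div_const 2
    have e2 := (hasDerivAt_const x α).div h1 h0.ne'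
    have e3 := (hasDerivAt_const x α).div ((h1.pow 2).const_mul 2)
      (mul_ne_zero two_ne_zero (pow_ne_zero 2 h0.ne'))
    refine ((e1.sub e2).add e3).congr_deriv ?_
    rw [h3]
    simp only [Pi.pow_apply]
    field_simp
    ring
  exact hJ.is_const_of_deriv_eq_zero hJc
    (fun x hx => (key x hx).differentiableAt.differentiableWithinAt)
    (fun x hx => (key x hx).deriv) ht hs

/-- Energy conservation gives (φφ')² = 2Eφ² + 2αφ − α, which is at most C²(1 + φ²) whatever the sign
of α. Hence √(1 + φ²) is Lipschitz with constant C. -/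
theorem exists_scaling_bound (hJ : IsOpen J) (hJc : IsPreconnected J)
    (hφ : ∀ t ∈ J, 0 < φ t ∧ HasDerivAt φ (φ' t) t ∧ HasDerivAt φ' (φ'' t) t ∧
      φ'' t = α * (-(1 / φ t ^ 2) + 1 / φ t ^ 3)) {s : ℝ} (hs : s ∈ J) :
    ∃ C, 0 ≤ C ∧ ∀ t ∈ J, |φ t * φ' t| ≤ C * √(1 + φ t ^ 2) ∧
      √(1 + φ t ^ 2) ≤ √(1 + φ s ^ 2) + C * |t - s| := by
  set E := φ' s ^ 2 / 2 - α / φ s + α / (2 * φ s ^ 2) with hE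
  set C := √(2 * |E| + 2 * |α|) with hC
  have hC2 : C ^ 2 = 2 * |E| + 2 * |α| := Real.sq_sqrt (by positivity)
  have h1 : ∀ t ∈ J, |φ t * φ' t| ≤ C * √(1 + φ t ^ 2) := by
    intro t ht
    have hen := scaling_energy_const hJ hJc hφ hs ht
    rw [← hE] at hen
    have h0 := (hφ t ht).1
    have h2 : (φ t * φ' t) ^ 2 = 2 * E * φ t ^ 2 + 2 * α * φ t - α := by
      rw [← hen]
      field_simp
      ring
    refine abs_le_of_sq_le_sq ?_ (by positivity)
    rw [mul_pow C, hC2, Real.sq_sqrt (by positivity), h2]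
    have a1 : E * φ t ^ 2 ≤ |E| * φ t ^ 2 := by gcongr; exact le_abs_self E
    have a2 : α * (2 * φ t - 1) ≤ |α| * (φ t ^ 2 + 2) := by
      calc α * (2 * φ t - 1) ≤ |α * (2 * φ t - 1)| := le_abs_self _
        _ = |α| * |2 * φ t - 1| := abs_mul _ _
        _ ≤ |α| * (φ t ^ 2 + 2) := by
          gcongr
          rw [abs_le]
          constructor <;> nlinarith [sq_nonneg (φ t - 1), sq_nonneg (φ t + 1)]
    have a3 : 0 ≤ |α| * φ t ^ 2 := by positivity
    have a4 : 0 ≤ |E| := abs_nonneg E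
    linarith
  refine ⟨C, Real.sqrt_nonneg _, fun t ht => ⟨h1 t ht, ?_⟩⟩
  have h2 : ∀ x ∈ J, HasDerivWithinAt (fun t => √(1 + φ t ^ 2))
      (φ x * φ' x / √(1 + φ x ^ 2)) J x := by
    intro x hx
    have h3 := (((hφ x hx).2.1.pow 2).const_add 1).sqrt (by simp only [Pi.pow_apply]; positivity)
    refine (h3.congr_deriv ?_).hasDerivWithinAt
    simp only [Pi.pow_apply]
    field_simp
    push_cast
    ring
  have h3 := Convex.norm_image_sub_le_of_norm_hasDerivWithin_le h2 (C := C) (fun x hx => ?_)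
    hJc.ordConnected.convex hs ht
  · have h4 := (le_abs_self _).trans h3
    rw [Real.norm_eq_abs] at h4
    linarith
  · have hp : 0 < √(1 + φ x ^ 2) := by positivity
    rw [norm_div, Real.norm_eq_abs, Real.norm_of_nonneg hp.le, div_le_iff₀ hp]
    exact h1 x hx

end scalingFactor

namespace IsReducedTransport

variable {R P : ℝ × ℝ × ℝ → ℝ} {S : Set (ℝ × ℝ)} {α : ℝ} {φ φ' φ'' : ℝ → ℝ}

/-- The pair (φ, φ') stays in a compact set with φ > 0 as t → T, so it has a limit point (a, b). By
continuity of R and P the corresponding point at time T is mapped into S. -/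
theorem exists_mem_of_mem_closure (h : IsReducedTransport R P S) {J : Set ℝ} (hJ : IsOpen J)
    (hJc : IsPreconnected J)
    (hmono : ∀ t, StrictMonoOn (fun r => R (t, r, 0)) (Set.Ioi 0))
    (hlim : ∀ t, Tendsto (fun r => R (t, r, 0)) (𝓝[>] 0) (𝓝 0))
    (hφ : ∀ t ∈ J, 0 < φ t ∧ HasDerivAt φ (φ' t) t ∧ HasDerivAt φ' (φ'' t) t ∧
      φ'' t = α * (-(1 / φ t ^ 2) + 1 / φ t ^ 3))
    (hRP : ∀ t ∈ J, ∀ r p, (t, r, p) ∈ liftedSupport R P S →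
        R (t, r, p) = r / φ t ∧ P (t, r, p) = φ t * p - φ' t * r)
    (hS : ∀ t ∈ J, ∀ w ∈ S, (t, φ t * w.1, w.2 / φ t + φ' t * w.1) ∈ liftedSupport R P S)
    {T : ℝ} (hT : T ∈ closure J) : ∃ z ∈ liftedSupport R P S, z.1 = T := by
  have hne : (𝓝[J] T).NeBot := mem_closure_iff_nhdsWithin_neBot.1 hT
  obtain ⟨s, hs⟩ : J.Nonempty := closure_nonempty_iff.1 ⟨T, hT⟩
  obtain ⟨C, hC0, hC⟩ := exists_scaling_bound hJ hJc hφ hs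
  set B := √(1 + φ s ^ 2) + C * (|T - s| + 1) with hB
  have hB0 : 0 ≤ B := by positivity
  have hnear : ∀ᶠ t in 𝓝[J] T, t ∈ J := self_mem_nhdsWithin
  have hone : ∀ᶠ t in 𝓝[J] T, |t - T| < 1 :=
    nhdsWithin_le_nhds (eventually_abs_sub_lt (by simp))
  have hbd : ∀ᶠ t in 𝓝[J] T, √(1 + φ t ^ 2) ≤ B := by
    filter_upwards [hnear, hone] with t ht ht1
    refine (hC t ht).2.trans ?_
    have : |t - s| ≤ |T - s| + 1 := by
      calc |t - s| = |(t - T) + (T - s)| := by ring_nf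
        _ ≤ |t - T| + |T - s| := abs_add_le _ _
        _ ≤ |T - s| + 1 := by linarith
    rw [hB]
    gcongr
  -- the radius map on the axis bounds the scaling factor from below
  obtain ⟨ε, hε, hbox⟩ := h.box
  set M := C * B with hM
  have hM0 : 0 ≤ M := by positivity
  -- Small enough that (X₀, −φφ'X₀) lies in the box inside S, as |φφ'| ≤ M. Its preimage is (t, φX₀,
  -- 0), on the axis where the monotonicity of R is available.
  set X₀ := ε / (2 * (M + 1)) with hX₀
  have hX0 : 0 < X₀ := by positivity
  have hXε : X₀ < ε := by
    rw [hX₀, div_lt_iff₀ (by positivity)]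
    nlinarith
  have hMX : M * X₀ < ε := by
    rw [hX₀, mul_div_assoc', div_lt_iff₀ (by positivity)]
    nlinarith
  obtain ⟨r₀, hr₀, hRr₀⟩ : ∃ r₀ : ℝ, 0 < r₀ ∧ R (T, r₀, 0) < X₀ := by
    have h1 : ∀ᶠ r in 𝓝[>] (0 : ℝ), 0 < r := self_mem_nhdsWithin
    exact (h1.and ((hlim T).eventually_lt_const hX0)).exists
  have hRt : ∀ᶠ t in 𝓝[J] T, R (t, r₀, 0) < X₀ := by
    have hc := (hasDerivAt_time (h.differentiableAt_radius (z := (T, r₀, 0)) hr₀)).continuousAt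
    exact nhdsWithin_le_nhds (hc.eventually_lt_const hRr₀)
  set c := r₀ / X₀ with hc
  have hc0 : 0 < c := by positivity
  have hpair : ∀ᶠ t in 𝓝[J] T, (φ t, φ' t) ∈ Set.Icc c B ×ˢ Set.Icc (-(M / c)) (M / c) := by
    filter_upwards [hnear, hbd, hRt] with t ht htB htR
    have h0 := (hφ t ht).1
    have h1 : |φ t * φ' t| ≤ M := (hC t ht).1.trans (by rw [hM]; gcongr)
    have h2 : φ t ≤ B := by
      refine le_trans ?_ htB
      refine Real.le_sqrt_of_sq_le ?_
      linarith
    have h3 : (X₀, -(φ t * φ' t) * X₀) ∈ S := by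
      refine hbox _ _ hX0 hXε ?_
      rw [abs_mul, abs_neg, abs_of_pos hX0]
      exact lt_of_le_of_lt (by gcongr) hMX
    have h4 := hS t ht _ h3
    have h5 : (t, φ t * X₀, -(φ t * φ' t) * X₀ / φ t + φ' t * X₀) = (t, φ t * X₀, (0 : ℝ)) := by
      refine Prod.ext rfl (Prod.ext rfl ?_)
      simp only
      field_simp
      ring
    rw [h5] at h4
    have h6 : R (t, φ t * X₀, 0) = X₀ := by
      rw [(hRP t ht _ _ h4).1]
      field_simp
    -- If φX₀ < r₀, monotonicity would give X₀ = R(t, φX₀, 0) < R(t, r₀, 0) < X₀.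
    have h7 : c ≤ φ t := by
      rw [hc, div_le_iff₀ hX0]
      by_contra! hlt
      have := hmono t (mul_pos h0 hX0) hr₀ hlt
      simp only [h6] at this
      linarith
    refine ⟨⟨h7, h2⟩, ?_⟩
    rw [Set.mem_Icc, ← abs_le, le_div_iff₀ hc0]
    calc |φ' t| * c ≤ |φ' t| * φ t := by gcongr
      _ = |φ t * φ' t| := by rw [abs_mul, abs_of_pos h0, mul_comm]
      _ ≤ M := h1
  -- pass to a limit along an ultrafilter
  set U := Ultrafilter.of (𝓝[J] T) with hU
  have hUle : (U : Filter ℝ) ≤ 𝓝[J] T := Ultrafilter.of_le _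
  obtain ⟨⟨a, b⟩, hab, hle⟩ := (isCompact_Icc.prod isCompact_Icc).ultrafilter_le_nhds
    (U.map fun t => (φ t, φ' t)) (le_principal_iff.2 (hUle hpair))
  have hlimU : Tendsto (fun t => (φ t, φ' t)) U (𝓝 (a, b)) := hle
  have ha : Tendsto φ U (𝓝 a) := (continuous_fst.tendsto _).comp hlimU
  have hb : Tendsto φ' U (𝓝 b) := (continuous_snd.tendsto _).comp hlimU
  have ha0 : 0 < a := hc0.trans_le hab.1.1
  have hwS : (ε / 2, (0 : ℝ)) ∈ S := hbox _ _ (by positivity) (by linarith) (by simpa)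
  have hid : Tendsto (fun t : ℝ => t) U (𝓝 T) := hUle.trans nhdsWithin_le_nhds
  have hz : Tendsto (fun t => (t, φ t * (ε / 2), 0 / φ t + φ' t * (ε / 2))) U
      (𝓝 (T, a * (ε / 2), 0 / a + b * (ε / 2))) :=
    hid.prodMk_nhds ((ha.mul_const _).prodMk_nhds
      ((tendsto_const_nhds.div ha ha0.ne').add (hb.mul_const _)))
  have hpos : 0 < ((T, a * (ε / 2), 0 / a + b * (ε / 2)) : ℝ × ℝ × ℝ).2.1 := by
    simp only
    positivity
  have hval : ∀ᶠ t in (U : Filter ℝ), R (t, φ t * (ε / 2), 0 / φ t + φ' t * (ε / 2)) = ε / 2 ∧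
      P (t, φ t * (ε / 2), 0 / φ t + φ' t * (ε / 2)) = 0 := by
    filter_upwards [hUle hnear] with t ht
    have h0 := (hφ t ht).1
    obtain ⟨h1, h2⟩ := hRP t ht _ _ (hS t ht _ hwS)
    rw [h1, h2]
    constructor
    · field_simp
    · field_simp
      ring
  have hR : R (T, a * (ε / 2), 0 / a + b * (ε / 2)) = ε / 2 :=
    tendsto_nhds_unique ((h.differentiableAt_radius hpos).continuousAt.tendsto.comp hz)
      (tendsto_const_nhds.congr' (hval.mono fun t ht => ht.1.symm))
  have hP : P (T, a * (ε / 2), 0 / a + b * (ε / 2)) = 0 :=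
    tendsto_nhds_unique ((h.differentiableAt_momentum hpos).continuousAt.tendsto.comp hz)
      (tendsto_const_nhds.congr' (hval.mono fun t ht => ht.2.symm))
  exact ⟨_, ⟨hpos, by rw [hR, hP]; exact hwS⟩, rfl⟩

/-- If the scaling factor obeys its equation of motion, the support is nonempty at all times. -/
theorem forall_exists_mem (h : IsReducedTransport R P S)
    (hmono : ∀ t, StrictMonoOn (fun r => R (t, r, 0)) (Set.Ioi 0))
    (hlim : ∀ t, Tendsto (fun r => R (t, r, 0)) (𝓝[>] 0) (𝓝 0))
    (hφ : ∀ t, (∃ z ∈ liftedSupport R P S, z.1 = t) →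
      0 < φ t ∧ HasDerivAt φ (φ' t) t ∧ HasDerivAt φ' (φ'' t) t ∧
      φ'' t = α * (-(1 / φ t ^ 2) + 1 / φ t ^ 3))
    (hRP : ∀ t, (∃ z ∈ liftedSupport R P S, z.1 = t) → ∀ r p, (t, r, p) ∈ liftedSupport R P S →
        R (t, r, p) = r / φ t ∧ P (t, r, p) = φ t * p - φ' t * r)
    (hS : ∀ t, (∃ z ∈ liftedSupport R P S, z.1 = t) → ∀ w ∈ S,
      (t, φ t * w.1, w.2 / φ t + φ' t * w.1) ∈ liftedSupport R P S)
    (hne : (liftedSupport R P S).Nonempty) (t : ℝ) : ∃ z ∈ liftedSupport R P S, z.1 = t := by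
  set I : Set ℝ := Prod.fst '' liftedSupport R P S with hI
  have hIo : IsOpen I := isOpenMap_fst _ h.isOpen_liftedSupport
  obtain ⟨z₀, hz₀⟩ := hne
  have hz₀I : z₀.1 ∈ I := ⟨z₀, hz₀, rfl⟩
  set J := connectedComponentIn I z₀.1 with hJ
  have hJI : J ⊆ I := connectedComponentIn_subset _ _
  have hJo : IsOpen J := hIo.connectedComponentIn
  have hJc : IsPreconnected J := isPreconnected_connectedComponentIn
  have hcl : closure J ∩ Set.univ ⊆ J := by
    rintro T ⟨hT, -⟩
    have hTI : T ∈ I := h.exists_mem_of_mem_closure hJo hJc hmono hlim (fun t ht => hφ t (hJI ht))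
      (fun t ht => hRP t (hJI ht)) (fun t ht => hS t (hJI ht)) hT
    -- Adding a closure point keeps J connected, so maximality of the component puts T in J.
    have hpre : IsPreconnected (insert T J) := hJc.subset_closure (Set.subset_insert _ _)
      (Set.insert_subset hT subset_closure)
    exact hpre.subset_connectedComponentIn
      (Set.mem_insert_of_mem _ (mem_connectedComponentIn hz₀I))
      (Set.insert_subset hTI hJI) (Set.mem_insert _ _)
  have := isPreconnected_univ.subset_of_closure_inter_subset hJo
    ⟨z₀.1, trivial, mem_connectedComponentIn hz₀I⟩ hcl
  exact hJI (this (Set.mem_univ t))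

/-- The equation of motion of the scaling factor, from the `β`-independent part of the transport
equation with force `-g`. -/
theorem acceleration (h : IsReducedTransport R P S) {g : ℝ → ℝ → ℝ} {u' : ℝ → ℝ}
    (hφ : ∀ t, (∃ z ∈ liftedSupport R P S, z.1 = t) →
      0 < φ t ∧ HasDerivAt φ (φ' t) t ∧ HasDerivAt φ' (φ'' t) t ∧
      (∀ r p, (t, r, p) ∈ liftedSupport R P S →
        R (t, r, p) = r / φ t ∧ P (t, r, p) = φ t * p - φ' t * r) ∧
      ∀ w ∈ S, (t, φ t * w.1, w.2 / φ t + φ' t * w.1) ∈ liftedSupport R P S)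
    (hforce : ∀ z ∈ liftedSupport R P S,
      P z * (fderiv ℝ P z (1, 0, 0) + z.2.2 * fderiv ℝ P z (0, 1, 0)
        - g z.1 z.2.1 * fderiv ℝ P z (0, 0, 1))
      + u' (R z) * (fderiv ℝ R z (1, 0, 0) + z.2.2 * fderiv ℝ R z (0, 1, 0)) = 0)
    {t r p : ℝ} (hz : (t, r, p) ∈ liftedSupport R P S) :
    φ'' t * r + g t r * φ t = u' (r / φ t) / φ t ^ 2 := by
  obtain ⟨h0, h1, h2, h3, -⟩ := hφ t ⟨_, hz, rfl⟩
  -- choose a momentum which is not mapped to zero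
  obtain ⟨q, hq, hPq⟩ : ∃ q, (t, r, q) ∈ liftedSupport R P S ∧ P (t, r, q) ≠ 0 := by
    by_cases hP0 : P (t, r, p) = 0
    · obtain ⟨ε, hε, hb⟩ := h.exists_ball hz
      have hm : (t, r, p + ε / 2) ∈ liftedSupport R P S := by
        refine hb _ _ _ (by simpa) (by simpa) ?_
        simp only [add_sub_cancel_left]
        rw [abs_of_pos (by positivity)]
        linarith
      refine ⟨_, hm, ?_⟩
      have e1 := (h3 _ _ hz).2
      rw [(h3 _ _ hm).2]
      have : φ t * (p + ε / 2) - φ' t * r = φ t * (ε / 2) := by linarith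
      rw [this]
      positivity
    · exact ⟨p, hz, hP0⟩
  have hr : 0 < r := hz.1
  have hopen : ∀ᶠ z in 𝓝 ((t, r, q) : ℝ × ℝ × ℝ), z ∈ liftedSupport R P S :=
    h.isOpen_liftedSupport.mem_nhds hq
  have lt : Tendsto (fun s : ℝ => (s, r, q)) (𝓝 t) (𝓝 (t, r, q)) :=
    hasDerivAt_line_time.continuousAt
  have lr : Tendsto (fun s : ℝ => (t, s, q)) (𝓝 r) (𝓝 (t, r, q)) :=
    hasDerivAt_line_radius.continuousAt
  have lp : Tendsto (fun s : ℝ => (t, r, s)) (𝓝 q) (𝓝 (t, r, q)) :=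
    hasDerivAt_line_momentum.continuousAt
  have hPd := h.differentiableAt_momentum hq.1
  have hRd := h.differentiableAt_radius hq.1
  have hval : ∀ s ρ π, (s, ρ, π) ∈ liftedSupport R P S →
      R (s, ρ, π) = ρ / φ s ∧ P (s, ρ, π) = φ s * π - φ' s * ρ := fun s ρ π hm =>
    (hφ s ⟨_, hm, rfl⟩).2.2.2.1 ρ π hm
  have Pt : fderiv ℝ P (t, r, q) (1, 0, 0) = φ' t * q - φ'' t * r := by
    refine (hasDerivAt_time hPd).unique (((h1.mul_const q).sub
      (h2.mul_const r)).congr_of_eventuallyEq ?_)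
    filter_upwards [lt.eventually hopen] with s hs using (hval _ _ _ hs).2
  have Pr : fderiv ℝ P (t, r, q) (0, 1, 0) = -φ' t := by
    refine (hasDerivAt_radius hPd).unique (HasDerivAt.congr_of_eventuallyEq
      (f := fun s => φ t * q - φ' t * s) ?_ ?_)
    · simpa using ((hasDerivAt_id r).const_mul (φ' t)).const_sub (φ t * q)
    · filter_upwards [lr.eventually hopen] with s hs using (hval _ _ _ hs).2
  have Pp : fderiv ℝ P (t, r, q) (0, 0, 1) = φ t := by
    refine (hasDerivAt_momentum hPd).unique (HasDerivAt.congr_of_eventuallyEq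
      (f := fun s => φ t * s - φ' t * r) ?_ ?_)
    · simpa using ((hasDerivAt_id q).const_mul (φ t)).sub_const (φ' t * r)
    · filter_upwards [lp.eventually hopen] with s hs using (hval _ _ _ hs).2
  have Rt : fderiv ℝ R (t, r, q) (1, 0, 0) = -(r * φ' t) / φ t ^ 2 := by
    refine (hasDerivAt_time hRd).unique (HasDerivAt.congr_of_eventuallyEq
      (f := fun s => r / φ s) ?_ ?_)
    · exact ((hasDerivAt_const t r).div h1 h0.ne').congr_deriv (by simp)
    · filter_upwards [lt.eventually hopen] with s hs using (hval _ _ _ hs).1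
  have Rr : fderiv ℝ R (t, r, q) (0, 1, 0) = 1 / φ t := by
    refine (hasDerivAt_radius hRd).unique (HasDerivAt.congr_of_eventuallyEq
      (f := fun s => s / φ t) ?_ ?_)
    · exact (hasDerivAt_id r).div_const (φ t)
    · filter_upwards [lr.eventually hopen] with s hs using (hval _ _ _ hs).1
  have hF := hforce _ hq
  simp only [Pt, Pr, Pp, Rt, Rr, (hval _ _ _ hq).1] at hF
  have hv := (hval _ _ _ hq).2
  -- The velocity-dependent terms combine so that P factors out of the whole identity.
  have hfac : P (t, r, q) * (φ'' t * r + g t r * φ t - u' (r / φ t) / φ t ^ 2) = 0 := by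
    have e : -(r * φ' t) / φ t ^ 2 + q * (1 / φ t) = P (t, r, q) / φ t ^ 2 := by
      rw [hv]
      field_simp
      ring
    rw [e] at hF
    linear_combination -hF
  have := (mul_eq_zero.1 hfac).resolve_left hPq
  linarith

end IsReducedTransport

/-! ### From the Vlasov–Poisson system to the reduced transport equations -/

section reduction

variable {Qt : ℝ → ℝ → ℝ} {Q : E3 → E3 → ℝ} {f : ℝ → E3 → E3 → ℝ} {R P : ℝ × ℝ × ℝ → ℝ}

theorem radialMomentum_isometry (A : E3 ≃ₗᵢ[ℝ] E3) (x v : E3) :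
    radialMomentum (A x) (A v) = radialMomentum x v := by
  rw [radialMomentum, radialMomentum, A.inner_map_map, A.norm_map]

theorem angMomSq_isometry (A : E3 ≃ₗᵢ[ℝ] E3) (x v : E3) :
    angMomSq (A x) (A v) = angMomSq x v := by
  rw [angMomSq, angMomSq, A.inner_map_map, A.norm_map, A.norm_map]

theorem potential_isometry_of_radial
    (hform : ∀ t x v, x ≠ 0 →
      f t x v = Qt (radialEnergy Q (R (t, ‖x‖, radialMomentum x v))
        (P (t, ‖x‖, radialMomentum x v)) (angMomSq x v)) (angMomSq x v))
    (t : ℝ) (A : E3 ≃ₗᵢ[ℝ] E3) (x : E3) : potential (f t) (A x) = potential (f t) x := by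
  refine potential_comp_isometry A (fun x hx v => ?_) x
  have hAx : A x ≠ 0 := by
    rw [← norm_pos_iff, A.norm_map]
    exact norm_pos_iff.2 hx
  rw [hform t _ _ hAx, hform t _ _ hx, radialMomentum_isometry, angMomSq_isometry, A.norm_map]

theorem mem_liftedSupport_of_ne (hQ : IsSteadyState Qt Q)
    (hRpos : ∀ z : ℝ × ℝ × ℝ, 0 < z.2.1 → 0 < R z)
    (hform : ∀ t x v, x ≠ 0 →
      f t x v = Qt (radialEnergy Q (R (t, ‖x‖, radialMomentum x v))
        (P (t, ‖x‖, radialMomentum x v)) (angMomSq x v)) (angMomSq x v))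
    {t : ℝ} {x v : E3} (hx : x ≠ 0) (h : f t x v ≠ 0) :
    (t, ‖x‖, radialMomentum x v) ∈ liftedSupport R P (reducedSupport Q) := by
  have hr : 0 < ‖x‖ := norm_pos_iff.2 hx
  rw [hform t x v hx] at h
  exact ⟨hr, hQ.mem_reducedSupport_of_ne (hRpos _ hr) (angMomSq_nonneg x v) h⟩

theorem transport_coefficients (hQ : IsSteadyState Qt Q) (hf : IsVPSolution f)
    (hRpos : ∀ z : ℝ × ℝ × ℝ, 0 < z.2.1 → 0 < R z)
    (hRd : ∀ z : ℝ × ℝ × ℝ, 0 < z.2.1 → DifferentiableAt ℝ R z)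
    (hPd : ∀ z : ℝ × ℝ × ℝ, 0 < z.2.1 → DifferentiableAt ℝ P z)
    (hform : ∀ t x v, x ≠ 0 →
      f t x v = Qt (radialEnergy Q (R (t, ‖x‖, radialMomentum x v))
        (P (t, ‖x‖, radialMomentum x v)) (angMomSq x v)) (angMomSq x v))
    (hQe : ∀ x v, Q x v ≠ 0 →
      DifferentiableWithinAt ℝ (fun w : ℝ × ℝ => Qt w.1 w.2) {w | 0 ≤ w.2}
        (‖v‖ ^ 2 / 2 + potential Q x, angMomSq x v) ∧
      deriv (fun e => Qt e (angMomSq x v)) (‖v‖ ^ 2 / 2 + potential Q x) ≠ 0)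
    {z : ℝ × ℝ × ℝ} (hz : z ∈ liftedSupport R P (reducedSupport Q)) :
    fderiv ℝ R z (0, 0, 1) = 0 ∧
    P z * fderiv ℝ P z (0, 0, 1) * R z ^ 3
      = z.2.1 ^ 3 * (fderiv ℝ R z (1, 0, 0) + z.2.2 * fderiv ℝ R z (0, 1, 0)) ∧
    P z * (fderiv ℝ P z (1, 0, 0) + z.2.2 * fderiv ℝ P z (0, 1, 0)
        - deriv (fun s => potential (f z.1) (planar s 0)) z.2.1 * fderiv ℝ P z (0, 0, 1))
      + deriv (radialPotential Q) (R z)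
        * (fderiv ℝ R z (1, 0, 0) + z.2.2 * fderiv ℝ R z (0, 1, 0)) = 0 := by
  obtain ⟨t, r, p⟩ := z
  have hr : 0 < r := hz.1
  have hR0 := hRpos _ hz.1
  obtain ⟨q, hq⟩ := hQ.exists_planar hz.2
  simp only at hq
  set q₀ := R (t, r, p) * q / r with hq₀
  have hne : f t (planar r 0) (planar p q₀) ≠ 0 := by
    rw [hform t _ _ (planar_ne_zero hr), radialMomentum_planar hr, norm_planar_zero hr.le,
      angMomSq_planar, zero_mul, sub_zero, hq₀, mul_div_cancel₀ _ hr.ne', ← hQ.eq_planar hR0]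
    exact hq
  have hcont : Continuous fun q => (t, planar r 0, planar p q) :=
    continuous_const.prodMk (continuous_const.prodMk
      (continuous_planar.comp (by fun_prop : Continuous fun q : ℝ => (p, q))))
  have hev : ∀ᶠ q in 𝓝 q₀, f t (planar r 0) (planar p q) ≠ 0 :=
    (hf.isOpen_ne.preimage hcont).mem_nhds hne
  set g := deriv (fun s => potential (f t) (planar s 0)) r with hg
  set Rt := fderiv ℝ R (t, r, p) (1, 0, 0)
  set Rr := fderiv ℝ R (t, r, p) (0, 1, 0)
  set Rp := fderiv ℝ R (t, r, p) (0, 0, 1)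
  set Pt := fderiv ℝ P (t, r, p) (1, 0, 0)
  set Pr := fderiv ℝ P (t, r, p) (0, 1, 0)
  set Pp := fderiv ℝ P (t, r, p) (0, 0, 1)
  set u' := deriv (radialPotential Q) (R (t, r, p))
  have hpoly : ∀ᶠ q in 𝓝 q₀, (P (t, r, p) * (Pt + p * Pr - g * Pp) + u' * (Rt + p * Rr - g * Rp))
      + (P (t, r, p) * Pp / r + u' * Rp / r - r ^ 2 / R (t, r, p) ^ 3 * (Rt + p * Rr - g * Rp))
        * q ^ 2 + (-(r * Rp / R (t, r, p) ^ 3)) * q ^ 4 = 0 := by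
    filter_upwards [hev] with q hq
    have := radial_vlasov hQ hf hform hQe (potential_isometry_of_radial hform t) hr hq hg
      (hRd _ hz.1) (hPd _ hz.1) hR0
    rw [← this]
    field_simp
    ring
  obtain ⟨h0, h2, h4⟩ := coeffs_eq_zero_of_eventually hpoly
  have hRp : Rp = 0 := by
    have : r * Rp / R (t, r, p) ^ 3 = 0 := neg_eq_zero.1 h4
    rw [div_eq_zero_iff, mul_eq_zero] at this
    exact (this.resolve_right (pow_ne_zero 3 hR0.ne')).resolve_left hr.ne'
  rw [hRp] at h0 h2
  refine ⟨hRp, ?_, ?_⟩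
  · simp only [mul_zero, zero_div, add_zero, sub_zero] at h2
    field_simp at h2
    simp only
    linear_combination h2
  · simpa using h0

theorem potential_of_scaling {t φ φ' : ℝ} (hφ : 0 < φ)
    (hfQ : ∀ x, x ≠ 0 → ∀ v, f t x v = Q (φ⁻¹ • x) (φ • v - φ' • x)) (x : E3) :
    potential (f t) x = φ⁻¹ * potential Q (φ⁻¹ • x) := by
  rw [potential_congr hfQ, potential_scaling hφ]

/-- On the lifted support this is the linear form of (R, P). Off it both sides vanish: a nonzero
value of Q on the right would, through `hS`, put the point into the lifted support. -/
theorem eq_scaled_steadyState (hQ : IsSteadyState Qt Q)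
    (hRpos : ∀ z : ℝ × ℝ × ℝ, 0 < z.2.1 → 0 < R z)
    (hform : ∀ t x v, x ≠ 0 →
      f t x v = Qt (radialEnergy Q (R (t, ‖x‖, radialMomentum x v))
        (P (t, ‖x‖, radialMomentum x v)) (angMomSq x v)) (angMomSq x v))
    {t φ φ' : ℝ} (hφ : 0 < φ)
    (hRP : ∀ r p, (t, r, p) ∈ liftedSupport R P (reducedSupport Q) →
        R (t, r, p) = r / φ ∧ P (t, r, p) = φ * p - φ' * r)
    (hS : ∀ w ∈ reducedSupport Q,
      (t, φ * w.1, w.2 / φ + φ' * w.1) ∈ liftedSupport R P (reducedSupport Q))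
    {x : E3} (hx : x ≠ 0) (v : E3) : f t x v = Q (φ⁻¹ • x) (φ • v - φ' • x) := by
  have hr : 0 < ‖x‖ := norm_pos_iff.2 hx
  have hy : φ⁻¹ • x ≠ 0 := smul_ne_zero (inv_ne_zero hφ.ne') hx
  have hn : ‖φ⁻¹ • x‖ = ‖x‖ / φ := by
    rw [norm_smul, norm_inv, Real.norm_of_nonneg hφ.le]
    field_simp
  have hp : radialMomentum (φ⁻¹ • x) (φ • v - φ' • x) = φ * radialMomentum x v - φ' * ‖x‖ := by
    rw [radialMomentum, radialMomentum, hn, inner_sub_right, inner_smul_left, inner_smul_left,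
      inner_smul_right, inner_smul_right, real_inner_self_eq_norm_sq]
    simp only [conj_trivial]
    field_simp
  have hβ : angMomSq (φ⁻¹ • x) (φ • v - φ' • x) = angMomSq x v := by
    rw [angMomSq, angMomSq, hn, ← real_inner_self_eq_norm_sq (φ • v - φ' • x)]
    simp only [inner_sub_right, inner_sub_left, inner_smul_left, inner_smul_right,
      real_inner_self_eq_norm_sq, conj_trivial, real_inner_comm x v]
    field_simp
    ring
  by_cases hm : (t, ‖x‖, radialMomentum x v) ∈ liftedSupport R P (reducedSupport Q)
  · obtain ⟨h1, h2⟩ := hRP _ _ hm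
    rw [hform t x v hx, hQ.eq_radial hy, hn, hp, hβ, h1, h2]
  · have h1 : f t x v = 0 := by
      by_contra h
      exact hm (mem_liftedSupport_of_ne hQ hRpos hform hx h)
    have h2 : Q (φ⁻¹ • x) (φ • v - φ' • x) = 0 := by
      by_contra h
      have h3 := hS _ ⟨_, _, hy, h, rfl⟩
      rw [hn, hp] at h3
      refine hm ?_
      have e : (t, ‖x‖, radialMomentum x v) = (t, φ * (‖x‖ / φ),
          (φ * radialMomentum x v - φ' * ‖x‖) / φ + φ' * (‖x‖ / φ)) := by
        refine Prod.ext rfl (Prod.ext ?_ ?_)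
        · simp only
          field_simp
        · simp only
          field_simp
          ring
      rw [e]
      exact h3
    rw [h1, h2]

theorem deriv_potential_of_scaling {t φ φ' r : ℝ} (hφ : 0 < φ)
    (hfQ : ∀ x, x ≠ 0 → ∀ v, f t x v = Q (φ⁻¹ • x) (φ • v - φ' • x))
    (hd : DifferentiableAt ℝ (radialPotential Q) (r / φ)) :
    deriv (fun s => potential (f t) (planar s 0)) r
      = deriv (radialPotential Q) (r / φ) / φ ^ 2 := by
  have h1 : (fun s => potential (f t) (planar s 0)) = fun s => φ⁻¹ * radialPotential Q (s / φ) := by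
    funext s
    rw [potential_of_scaling hφ hfQ, smul_planar, mul_zero, ← radialPotential_eq,
      inv_mul_eq_div φ s]
  have h2 := (HasDerivAt.comp r hd.hasDerivAt ((hasDerivAt_id r).div_const φ)).const_mul φ⁻¹
  rw [h1]
  refine h2.deriv.trans ?_
  field_simp

/-- For a steady state with `U_Q' = α r` on its support, `U_Q''(0) = α`. -/
theorem hasDerivAt_deriv_radialPotential (hQ : IsSteadyState Qt Q) (hc : ∃ v, Q 0 v ≠ 0)
    (hU0 : HasDerivAt (radialPotential Q) 0 0) {α : ℝ}
    (hα : ∀ w ∈ reducedSupport Q, deriv (radialPotential Q) w.1 = α * w.1) :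
    HasDerivAt (deriv (radialPotential Q)) α 0 := by
  obtain ⟨ε, hε, hbox⟩ := hQ.exists_box hc
  have hpos : ∀ r, 0 < r → r < ε → deriv (radialPotential Q) r = α * r := fun r h0 h1 =>
    hα (r, 0) (hbox r 0 h0 h1 (by simpa))
  have hl : HasDerivAt (fun r : ℝ => α * r) α 0 := by
    simpa using (hasDerivAt_id (0 : ℝ)).const_mul α
  refine hl.congr_of_eventuallyEq ?_
  have hnear : ∀ᶠ r in 𝓝 (0 : ℝ), |r - 0| < ε :=
    IsReducedTransport.eventually_abs_sub_lt (by simpa)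
  filter_upwards [hnear] with r hr
  rw [sub_zero, abs_lt] at hr
  rcases lt_trichotomy r 0 with h | rfl | h
  -- The potential is even, so its derivative is odd.
  · have h1 : deriv (fun s => radialPotential Q (-s)) r = -deriv (radialPotential Q) (-r) :=
      deriv_comp_neg _ _
    simp_rw [hQ.radialPotential_neg] at h1
    rw [h1, hpos (-r) (by linarith) (by linarith)]
    ring
  · rw [hU0.deriv, mul_zero]
  · exact hpos r h hr.2

end reduction

/-! ### Separation of variables and conclusion -/

theorem theorem1p1
    (Qt : ℝ → ℝ → ℝ) (Q : E3 → E3 → ℝ) (f : ℝ → E3 → E3 → ℝ)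
    (R P H : ℝ → ℝ → ℝ → ℝ)
    -- the steady state; its support is connected and contains the centre
    (hQ : IsSteadyState Qt Q)
    (hconn : IsConnected (reducedSupport Q))
    (hcentre : ∃ v, Q 0 v ≠ 0)
    -- regularity of the transformation
    (hR : ContDiffOn ℝ 2 (fun z : ℝ × ℝ × ℝ => R z.1 z.2.1 z.2.2) {z | 0 < z.2.1})
    (hP : ContDiffOn ℝ 2 (fun z : ℝ × ℝ × ℝ => P z.1 z.2.1 z.2.2) {z | 0 < z.2.1})
    -- the time-dependent solution generated from the steady state
    (hf : IsVPSolution f)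
    (hform : ∀ t x v, x ≠ 0 →
      f t x v = Qt (radialEnergy Q (R t ‖x‖ (radialMomentum x v))
        (P t ‖x‖ (radialMomentum x v)) (angMomSq x v)) (angMomSq x v))
    (htime : ∃ s t x v, x ≠ 0 ∧ f s x v ≠ f t x v)
    -- the evolution of (R, P) is Hamiltonian
    (hH : ∀ t, ContDiffOn ℝ 2 (fun z : ℝ × ℝ => H t z.1 z.2) {z | 0 < z.1})
    (hRt : ∀ t r p, 0 < r →
      HasDerivAt (fun s => R s r p) (deriv (fun q => H t (R t r p) q) (P t r p)) t)
    (hPt : ∀ t r p, 0 < r →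
      HasDerivAt (fun s => P s r p) (-deriv (fun q => H t q (P t r p)) (R t r p)) t)
    -- (a)
    (hQe : ∀ x v, Q x v ≠ 0 →
      DifferentiableWithinAt ℝ (fun w : ℝ × ℝ => Qt w.1 w.2) {w | 0 ≤ w.2}
        (‖v‖ ^ 2 / 2 + potential Q x, angMomSq x v) ∧
      deriv (fun e => Qt e (angMomSq x v)) (‖v‖ ^ 2 / 2 + potential Q x) ≠ 0)
    (hU0 : HasDerivAt (radialPotential Q) 0 0)
    -- (b)
    (hRr : ∀ t r p, 0 < r → 0 < deriv (fun q => R t q p) r)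
    (hσ : ∃ σ : ℝ → ℝ, ∀ t p, Tendsto (fun δ => R t δ p / δ) (𝓝[>] 0) (𝓝 (σ t)))
    -- (c)
    (hdet : ∀ r p, 0 < r →
      deriv (fun q => R 0 q p) r * deriv (fun q => P 0 r q) p
        - deriv (fun q => R 0 r q) p * deriv (fun q => P 0 q p) r = 1) :
    ∃ α : ℝ, HasDerivAt (deriv (radialPotential Q)) α 0 ∧
      (∀ x v, Q x v ≠ 0 → HasDerivAt (radialPotential Q) (α * ‖x‖) ‖x‖) ∧
      ∃ φ φ' : ℝ → ℝ,
        (∀ t, 0 < φ t ∧ HasDerivAt φ (φ' t) t ∧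
          HasDerivAt φ' (α * (-(1 / φ t ^ 2) + 1 / φ t ^ 3)) t) ∧
        ∀ t x v, x ≠ 0 → f t x v ≠ 0 →
          R t ‖x‖ (radialMomentum x v) = ‖x‖ / φ t ∧
          P t ‖x‖ (radialMomentum x v) = φ t * radialMomentum x v - φ' t * ‖x‖ := by
  set R' : ℝ × ℝ × ℝ → ℝ := fun z => R z.1 z.2.1 z.2.2
  set P' : ℝ × ℝ × ℝ → ℝ := fun z => P z.1 z.2.1 z.2.2
  obtain ⟨σ, hσ⟩ := hσ
  have hRpos : ∀ z : ℝ × ℝ × ℝ, 0 < z.2.1 → 0 < R' z := fun z hz =>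
    radius_map_pos (ρ := fun r => R z.1 r z.2.2) (fun r hr => hRr z.1 r z.2.2 hr)
      (hσ z.1 z.2.2) hz
  have hRd : ∀ z : ℝ × ℝ × ℝ, 0 < z.2.1 → DifferentiableAt ℝ R' z := fun z hz =>
    (hR.contDiffAt (isOpen_radius_pos.mem_nhds hz)).differentiableAt (by norm_num)
  have hPd : ∀ z : ℝ × ℝ × ℝ, 0 < z.2.1 → DifferentiableAt ℝ P' z := fun z hz =>
    (hP.contDiffAt (isOpen_radius_pos.mem_nhds hz)).differentiableAt (by norm_num)
  have hdet' : ∀ r p, 0 < r → fderiv ℝ R' (0, r, p) (0, 1, 0) * fderiv ℝ P' (0, r, p) (0, 0, 1)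
      - fderiv ℝ R' (0, r, p) (0, 0, 1) * fderiv ℝ P' (0, r, p) (0, 1, 0) = 1 := by
    intro r p hr
    rw [← (hasDerivAt_radius (hRd (0, r, p) hr)).deriv,
      ← (hasDerivAt_radius (hPd (0, r, p) hr)).deriv,
      ← (hasDerivAt_momentum (hRd (0, r, p) hr)).deriv,
      ← (hasDerivAt_momentum (hPd (0, r, p) hr)).deriv]
    exact hdet r p hr
  have hcoef := fun z (hz : z ∈ liftedSupport R' P' (reducedSupport Q)) =>
    transport_coefficients hQ hf hRpos hRd hPd hform hQe hz
  have hT : IsReducedTransport R' P' (reducedSupport Q) :=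
    { contDiffOn_radius := hR
      contDiffOn_momentum := hP
      radius_pos := hRpos
      jacobian := fun z hz => jacobian_eq_one hR hP hH hRpos hRt hPt hz (hdet' _ _ hz) z.1
      isOpen := hQ.isOpen_reducedSupport
      isPreconnected := hconn.isPreconnected
      pos := fun w hw => reducedSupport_pos hw
      box := hQ.exists_box hcentre
      momentum_deriv_radius := fun z hz => (hcoef z hz).1
      transport := fun z hz => (hcoef z hz).2.1 }
  obtain ⟨φ, φ', φ'', hφ⟩ := hT.exists_scaling
  have hfQ : ∀ t, (∃ z ∈ liftedSupport R' P' (reducedSupport Q), z.1 = t) → ∀ x, x ≠ 0 → ∀ v,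
      f t x v = Q ((φ t)⁻¹ • x) (φ t • v - φ' t • x) := by
    intro t ht x hx v
    obtain ⟨h0, -, -, h3, h4⟩ := hφ t ht
    exact eq_scaled_steadyState hQ hRpos hform h0 h3 h4 hx v
  have hacc : ∀ t, (∃ z ∈ liftedSupport R' P' (reducedSupport Q), z.1 = t) →
      ∀ w ∈ reducedSupport Q, φ'' t * w.1
        = deriv (radialPotential Q) w.1 * (-(1 / φ t ^ 2) + 1 / φ t ^ 3) := by
    intro t ht w hw
    obtain ⟨h0, -, -, -, h4⟩ := hφ t ht
    have e1 := hT.acceleration (u' := deriv (radialPotential Q))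
      (g := fun t r => deriv (fun s => potential (f t) (planar s 0)) r) hφ
      (fun z hz => (hcoef z hz).2.2) (h4 w hw)
    have e2 : φ t * w.1 / φ t = w.1 := by field_simp
    have hd := hQ.differentiableAt_radialPotential hw
    rw [← e2] at hd
    rw [deriv_potential_of_scaling h0 (hfQ t ht) hd, e2] at e1
    field_simp at e1 ⊢
    linear_combination e1
  obtain ⟨w₀, hw₀⟩ := hconn.nonempty
  have hw₀p : 0 < w₀.1 := reducedSupport_pos hw₀
  -- One radius fixes the constant of separation; the remaining radii follow once φ ≠ 1 at some
  -- time.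
  set α := deriv (radialPotential Q) w₀.1 / w₀.1 with hα
  have hode : ∀ t, (∃ z ∈ liftedSupport R' P' (reducedSupport Q), z.1 = t) →
      φ'' t = α * (-(1 / φ t ^ 2) + 1 / φ t ^ 3) := by
    intro t ht
    have := hacc t ht w₀ hw₀
    rw [← eq_div_iff hw₀p.ne'] at this
    rw [this, hα]
    ring
  obtain ⟨s, t, x, v, hx, hst⟩ := htime
  -- Two different values of f cannot both be zero.
  have hWne : (liftedSupport R' P' (reducedSupport Q)).Nonempty := by
    by_cases h : f s x v = 0
    · exact ⟨_, mem_liftedSupport_of_ne hQ hRpos hform hx (fun h' => hst (h.trans h'.symm))⟩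
    · exact ⟨_, mem_liftedSupport_of_ne hQ hRpos hform hx h⟩
  have hmono : ∀ t, StrictMonoOn (fun r => R' (t, r, 0)) (Set.Ioi 0) := fun t =>
    strictMonoOn_of_deriv_pos_Ioi (fun r hr => hRr t r 0 hr)
  have hall := hT.forall_exists_mem hmono
    (fun t => tendsto_zero_of_tendsto_div (hσ t 0))
    (fun t ht => ⟨(hφ t ht).1, (hφ t ht).2.1, (hφ t ht).2.2.1, hode t ht⟩)
    (fun t ht => (hφ t ht).2.2.2.1) (fun t ht => (hφ t ht).2.2.2.2) hWne
  have hne1 : ∃ t, φ t ≠ 1 := by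
    by_contra! h1
    have hconst : φ = fun _ => 1 := funext h1
    have hφ0 : ∀ t, φ' t = 0 := fun t => by
      have h2 := (hφ t (hall t)).2.1
      rw [hconst] at h2
      exact h2.unique (hasDerivAt_const t 1)
    have hstat : ∀ t, f t x v = Q x v := fun t => by
      rw [hfQ t (hall t) x hx v, h1, hφ0]
      simp
    exact hst ((hstat s).trans (hstat t).symm)
  obtain ⟨t₁, ht₁⟩ := hne1
  have hlin : ∀ w ∈ reducedSupport Q, deriv (radialPotential Q) w.1 = α * w.1 := by
    intro w hw
    have h0 := (hφ t₁ (hall t₁)).1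
    have e := hacc t₁ (hall t₁) w hw
    rw [hode t₁ (hall t₁)] at e
    -- The factor equals (1 − φ)/φ³ and vanishes only at φ = 1.
    have hd : -(1 / φ t₁ ^ 2) + 1 / φ t₁ ^ 3 ≠ 0 := by
      intro h
      field_simp at h
      exact ht₁ (by linarith)
    exact mul_right_cancel₀ hd (by linear_combination -e)
  refine ⟨α, hasDerivAt_deriv_radialPotential hQ hcentre hU0 hlin, ?_, φ, φ', ?_, ?_⟩
  · intro x v h
    by_cases hx0 : x = 0
    · simpa [hx0] using hU0
    · have hm : (‖x‖, radialMomentum x v) ∈ reducedSupport Q := ⟨x, v, hx0, h, rfl⟩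
      have := (hQ.differentiableAt_radialPotential hm).hasDerivAt
      rwa [hlin _ hm] at this
  · intro t
    obtain ⟨h0, h1, h2, -, -⟩ := hφ t (hall t)
    exact ⟨h0, h1, hode t (hall t) ▸ h2⟩
  · intro t x v hx0 h
    exact (hφ t (hall t)).2.2.2.1 _ _ (mem_liftedSupport_of_ne hQ hRpos hform hx0 h)
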